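/- **Setup.** Let $\mathbf k$ be a field, $P$ a partition of $n$, $n_i$ the multiplicity of the part $i$, $S_P=\{i : n_i\neq 0\}$, and for $i\in S_P$ not the smallest part let $i^-$ be the next smaller element of $S_P$. Let $S_P''$ be the set of minima of those maximal subsets of consecutive integers in $S_P$ that have odd cardinality. Let $V$ be the $\mathbf k$-vector space whose basis consists of the vertices $(u,i,k)$ with $i\in S_P$, $1\le u\le i$, $1\le k\le n_i$. Define maps, zero on all vertices not listed: - $\beta_i:(u,i,n_i)\mapsto(u,i^-,1)$ and $\alpha_i:(u,i^-,n_{i^-})\mapsto(u+i-i^-,i,1)$ for $1\le u\le i^-$, where $i\in S_P$, $i\ne\min S_P$; - $e_{j,k}:(u,j,k)\mapsto(u,j,k+1)$ for $1\le u\le j$, where $j\in S_P$, $1\le k<n_j$; - $w_\ell:(u,\ell,n_\ell)\mapsto(u+1,\ell,1)$ for $1\le u<\ell$, where $\ell\in S_P''$. The augmented diagram has an edge $v\to v'$ whenever one of these maps (which is then unique) sends $v$ to $v'$. Let $R$ be the polynomial ring over $\mathbf k$ in corresponding variables $s_i,t_i,t_{j,k},z_\ell$, and let $$A_R=\sum_i(s_i\beta_i+t_i\alpha_i)+\sum_{j,k}t_{j,k}e_{j,k}+\sum_{\ell}z_\ell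 w_\ell$$ be the simply adequate matrix. By a *chain* we mean a path in the augmented diagram; its length is its number of vertices, and its monomial is the product of the variables of its edges. Let $\mathfrak A=(a_1,\dots,a_s)$ with $a_i\in S_P$ and $a_i\ge a_{i+1}+2$, and put $\{\mathfrak A\}=\{a_1,a_1-1,\dots,a_s,a_s-1\}$. The vertex set $\{U_{\mathfrak A}\}$ consists of all vertices $(u,\ell,k)$ with $\ell\in\{\mathfrak A\}$, and of all vertices $(u,\ell,k)$ with $\ell>a_s$, $\ell\notin\{\mathfrak A\}$ and $u\le\#\{i: a_i<\ell\}$ or $u\ge \ell+1-\#\{i: a_i<\ell\}$. It is the disjoint union of the component chains $U_{\mathfrak A,\Upsilon}$, $1\le\Upsilon\le s$, where, with $b=a_{s+1-\Upsilon}$, $U_{\mathfrak A,\Upsilon}$ consists of the vertices $(u,\ell,k)$ with $\ell\in\{b,b-1\}$, $\Upsilon\le u\le\ell+1-\Upsilon$, and the vertices $(\Upsilon,\ell,k)$ and $(\ell+1-\Upsilon,\ell,k)$ with $\ell>b$. Its vertices $v_{\Upsilon,1},v_{\Upsilon,2},\dots$ are ordered as follows: first the vertices $(\Upsilon,\ell,\cdot)$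 with $\ell>b$, by decreasing $\ell$; then, for $u=\Upsilon,\Upsilon+1,\dots$, the vertices $(u,b,\cdot)$ followed by the vertices $(u,b-1,\cdot)$; then the vertices $(\ell+1-\Upsilon,\ell,\cdot)$ with $\ell>b$, by increasing $\ell$; vertices with the same $(u,\ell)$ are ordered by increasing $k$. Call $U_{\mathfrak A}$ *maximal* if $\{U_{\mathfrak A}\}$ is not a proper subset of $\{U_{\mathfrak A'}\}$ for another such $s$-tuple $\mathfrak A'$. Let $M_{\mathfrak A}$ be the square matrix with rows indexed by the pairs $(\Upsilon,u)$, $1\le\Upsilon\le s$, $0\le u<|U_{\mathfrak A,\Upsilon}|$, columns indexed by the vertices of $\{U_{\mathfrak A}\}$ (row $(\Upsilon,u)$ corresponding to column $v_{\Upsilon,u+1}$), whose entry in row $(\Upsilon,u)$ and column $v$ is the coefficient of $A_R^u(v_{\Upsilon,1})$ on $v$. The *standard chain* to $v_{\Upsilon,j}$ is $v_{\Upsilon,1}\to v_{\Upsilon,2}\to\cdots\to v_{\Upsilon,j}$, and the *distinguished monomial* $\mu_{\mathfrak A}$ is the product of the monomials of the standard chains to all vertices $v_{\Upsilon,j}$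 of $\{U_{\mathfrak A}\}$. A *chain factorization* $f=(\nu_f,\sigma_f,C_f)$ consists of a permutation $\sigma_f$ of $\{U_{\mathfrak A}\}$, an array $C_f$ that contains for each $(\Upsilon,u)$ a chain of length $u+1$ from $v_{\Upsilon,1}$ to $\sigma_f(v_{\Upsilon,u+1})$, and the array $\nu_f$ of the monomials of these chains; it is a factorization of $\pm\nu$, where $\nu$ is the product of the monomials in $\nu_f$. **Theorem 3.7.** Let $U_{\mathfrak A}$ be maximal. Then the identity permutation together with the standard chains is a chain factorization $g_{\mathfrak A}$ of $\mu_{\mathfrak A}$, and every chain factorization $f$ of $\pm\mu_{\mathfrak A}$ is equal to $g_{\mathfrak A}$. The coefficient of $\mu_{\mathfrak A}$ in $\det M_{\mathfrak A}$ is $1$; hence $\det M_{\mathfrak A}\ne0$. -/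

import Mathlib

namespace MultiUChain

open Finset MvPolynomial

variable {n : ℕ}

/-- `S_P`: the set of integers occurring as parts of the partition `P`. -/
def levels (P : n.Partition) : Finset ℕ := P.parts.toFinset

/-- `n_i`: the multiplicity of the part `i` in `P` (zero when `i` is not a part). -/
def mult (P : n.Partition) (i : ℕ) : ℕ := P.parts.count i

/-- `i⁻ = max {j ∈ S_P | j < i}`; only used when this set is nonempty. -/
def pred (P : n.Partition) (i : ℕ) : ℕ := ((levels P).filter (· < i)).sup id

/-- A maximal consecutive subsequence of `S_P`: a nonempty interval of integers contained in `S_P`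
and not properly contained in a larger such interval. -/
def IsMCS (P : n.Partition) (T : Finset ℕ) : Prop :=
  Maximal (fun T : Finset ℕ => (∃ a b, a ≤ b ∧ T = Icc a b) ∧ T ⊆ levels P) T

open Classical in
/-- `S_P''`: the minima of the maximal consecutive subsequences of `S_P` of odd cardinality. -/
noncomputable def oddMins (P : n.Partition) : Finset ℕ :=
  (levels P).filter fun l => ∃ T, IsMCS P T ∧ Odd T.card ∧ IsLeast (T : Set ℕ) l

/-- The vertices `(u, i, k)` of the poset `D_P`: `i ∈ S_P`, `1 ≤ u ≤ i` and `1 ≤ k ≤ n_i`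
(the last condition forces `i ∈ S_P`). -/
@[ext]
structure Vertex (P : n.Partition) where
  u : ℕ
  i : ℕ
  k : ℕ
  one_le_u : 1 ≤ u
  u_le : u ≤ i
  one_le_k : 1 ≤ k
  k_le : k ≤ mult P i

instance (P : n.Partition) : DecidableEq (Vertex P) := fun v w =>
  decidable_of_iff (v.u = w.u ∧ v.i = w.i ∧ v.k = w.k) Vertex.ext_iff.symm

lemma Vertex.i_mem {P : n.Partition} (v : Vertex P) : v.i ∈ levels P :=
  Multiset.mem_toFinset.2 (Multiset.count_pos.1 (lt_of_lt_of_le v.one_le_k v.k_le))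

instance (P : n.Partition) : Finite (Vertex P) := by
  let f : Vertex P → Σ i : levels P, Fin (i + 1) × Fin (mult P i + 1) := fun v =>
    ⟨⟨v.i, v.i_mem⟩, ⟨v.u, Nat.lt_succ_of_le v.u_le⟩, ⟨v.k, Nat.lt_succ_of_le v.k_le⟩⟩
  refine Finite.of_injective f ?_
  rintro ⟨u, i, k, _, _, _, _⟩ ⟨u', i', k', _, _, _, _⟩ h
  simp only [f, Sigma.mk.injEq, Subtype.mk.injEq] at h
  obtain ⟨rfl, h⟩ := h
  simp only [heq_eq_eq, Prod.mk.injEq, Fin.mk.injEq] at h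
  obtain ⟨rfl, rfl⟩ := h
  rfl

noncomputable instance (P : n.Partition) : Fintype (Vertex P) := Fintype.ofFinite _

/-- `S_P ∖ p_t`: the parts of `P` other than the smallest one. -/
abbrev NonMin (P : n.Partition) := {i // i ∈ (levels P).filter fun i => ∃ j ∈ levels P, j < i}

/-- The variables of the polynomial ring `R`: `s_i` and `t_i` for `i ∈ S_P ∖ p_t`, `t_{j,k}` for
`j ∈ S_P`, `1 ≤ k < n_j`, and `z_l` for `l ∈ S_P''`. They label the maps `β_i`, `α_i`,
`e_{j,k}` and `w_l` respectively. -/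
inductive Var (P : n.Partition)
  | s (i : NonMin P)
  | t (i : NonMin P)
  | e (j : {j // j ∈ levels P}) (k : {k // k ∈ Ico 1 (mult P j)})
  | z (l : {l // l ∈ oddMins P})

noncomputable instance (P : n.Partition) : Fintype (Var P) :=
  Fintype.ofEquiv
    (NonMin P ⊕ NonMin P ⊕ (Σ j : {j // j ∈ levels P}, {k // k ∈ Ico 1 (mult P j)}) ⊕
      {l // l ∈ oddMins P})
    { toFun := fun x => match x with
        | .inl i => .s i
        | .inr (.inl i) => .t i
        | .inr (.inr (.inl ⟨j, k⟩)) => .e j k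
        | .inr (.inr (.inr l)) => .z l
      invFun := fun x => match x with
        | .s i => .inl i
        | .t i => .inr (.inl i)
        | .e j k => .inr (.inr (.inl ⟨j, k⟩))
        | .z l => .inr (.inr (.inr l))
      left_inv := by rintro (i | i | ⟨j, k⟩ | l) <;> rfl
      right_inv := by rintro (i | i | ⟨j, k⟩ | l) <;> rfl }

/-- `Maps γ v v'`: the map labelled by `γ` sends the vertex `v` to the vertex `v'`, where
* `β_i : (u, i, n_i) ↦ (u, i⁻, 1)` for `1 ≤ u ≤ i⁻`;
* `α_i : (u, i⁻, n_{i⁻}) ↦ (u + i - i⁻, i, 1)` for `1 ≤ u ≤ i⁻`;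
* `e_{j,k} : (u, j, k) ↦ (u, j, k + 1)` for `1 ≤ u ≤ j`;
* `w_l : (u, l, n_l) ↦ (u + 1, l, 1)` for `1 ≤ u < l`;
all other vertices are sent to zero. -/
def Maps {P : n.Partition} (γ : Var P) (v v' : Vertex P) : Prop :=
  match γ with
  | .s i => v.i = i ∧ v.k = mult P i ∧ v'.u = v.u ∧ v'.i = pred P i ∧ v'.k = 1
  | .t i => v.i = pred P i ∧ v.k = mult P (pred P i) ∧
      v'.u + pred P i = v.u + i ∧ v'.i = i ∧ v'.k = 1
  | .e j k => v.i = j ∧ v.k = k ∧ v'.u = v.u ∧ v'.i = j ∧ v'.k = k + 1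
  | .z l => v.i = l ∧ v.k = mult P l ∧ v'.u = v.u + 1 ∧ v'.i = l ∧ v'.k = 1

/-- The edges `v → v'` of the augmented diagram of `D_P`: those of the maps `β_i`, `α_i`,
`e_{j,k}`, and `w_l` with `l ∈ S_P''`. (An isolated `l ∈ S_P` forms a maximal consecutive
subsequence of length one, so it lies in `S_P''`.) -/
def DiagAug (P : n.Partition) (v v' : Vertex P) : Prop := ∃ γ : Var P, Maps γ v v'

open Classical in
/-- The matrix of the map labelled by `γ` in the basis of vertices; here and below the entry of a
matrix in row `v` and column `v'` is the coefficient on `v'` of the image of `v`. -/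
noncomputable def elemMatrix (k : Type*) [Field k] {P : n.Partition} (γ : Var P) :
    Matrix (Vertex P) (Vertex P) (MvPolynomial (Var P) k) :=
  Matrix.of fun v v' => if Maps γ v v' then 1 else 0

/-- The simply adequate matrix
`A_R = ∑ (s_i β_i + t_i α_i) + ∑ t_{j,k} e_{j,k} + ∑ z_l w_l` over the polynomial ring `R`. -/
noncomputable def simplyAdequate (k : Type*) [Field k] (P : n.Partition) :
    Matrix (Vertex P) (Vertex P) (MvPolynomial (Var P) k) :=
  ∑ γ : Var P, (X γ : MvPolynomial (Var P) k) • elemMatrix k γ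

open Classical in
/-- The variable attached to an edge `v → v'` of the augmented diagram, as an exponent vector
(an edge comes from exactly one `γ`). -/
noncomputable def edgeMonomial {P : n.Partition} (v v' : Vertex P) : Var P →₀ ℕ :=
  ∑ γ : Var P, if Maps γ v v' then Finsupp.single γ 1 else 0

/-- The monomial `μ_p` of a chain `p` of the augmented diagram, as an exponent vector: the product
of the variables attached to the edges of `p`. -/
noncomputable def chainMonomial {P : n.Partition} (p : List (Vertex P)) : Var P →₀ ℕ :=
  (List.zipWith edgeMonomial p p.tail).sum

/-- The tuple `𝔄 = (a_1, …, a_s)`: `a_i ∈ S_P` and `a_i ≥ a_{i+1} + 2`. -/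
structure IsUTuple (P : n.Partition) {s : ℕ} (a : Fin s → ℕ) : Prop where
  mem : ∀ i, a i ∈ levels P
  gap : ∀ i j : Fin s, (i : ℕ) + 1 = j → a j + 2 ≤ a i

/-- `ℓ ∈ {𝔄} = {a_1, a_1 - 1, …, a_s, a_s - 1}`. -/
def InLevels {s : ℕ} (a : Fin s → ℕ) (l : ℕ) : Prop := ∃ i, l = a i ∨ l + 1 = a i

/-- `#{a_i < ℓ}`. -/
def numBelow {s : ℕ} (a : Fin s → ℕ) (l : ℕ) : ℕ := (univ.filter fun i => a i < l).card

/-- The vertex set `{U_𝔄}` of the `s`-`U`-chain of `𝔄`: all vertices on the levels in `{𝔄}` and,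
on each other level `ℓ > a_s`, those with `u ≤ #{a_i < ℓ}` or `u ≥ ℓ + 1 - #{a_i < ℓ}`. -/
def UVertices (P : n.Partition) {s : ℕ} (a : Fin s → ℕ) : Set (Vertex P) :=
  {v | InLevels a v.i ∨
    (¬ InLevels a v.i ∧ (∃ i, a i < v.i) ∧
      (v.u ≤ numBelow a v.i ∨ v.i + 1 ≤ v.u + numBelow a v.i))}

/-- `𝔄` defines a maximal `s`-`U`-chain: its vertex set is not a proper subset of the vertex set of
another `s`-`U`-chain, with the same `s`. -/
def IsMaximalUTuple (P : n.Partition) {s : ℕ} (a : Fin s → ℕ) : Prop :=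
  IsUTuple P a ∧ ∀ a' : Fin s → ℕ, IsUTuple P a' → ¬ UVertices P a ⊂ UVertices P a'

/-- The column `(u, i, 1), (u, i, 2), …, (u, i, n_i)` of vertices, from bottom to top; it is empty
when `i` is not a part or `u` is not between `1` and `i`. -/
def column (P : n.Partition) (u i : ℕ) : List (Vertex P) :=
  if h : 1 ≤ u ∧ u ≤ i then
    (List.finRange (mult P i)).map fun k : Fin (mult P i) =>
      ⟨u, i, (k : ℕ) + 1, h.1, h.2, Nat.le_add_left 1 k, k.isLt⟩
  else []

/-- The chain of `D_P` formed by the levels `b`, `b - 1` and the hooks above them, after `y - 1`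
outer layers have been removed: it descends along the left hook `(y, ℓ, ·)`, `ℓ > b`, runs through
the vertices `(u, ℓ, ·)` with `ℓ ∈ {b, b - 1}` and `y ≤ u ≤ ℓ + 1 - y`, and climbs along the right
hook `(ℓ + 1 - y, ℓ, ·)`, `ℓ > b`. -/
def hookChain (P : n.Partition) (y b : ℕ) : List (Vertex P) :=
  ((((levels P).filter (b < ·)).sort (· ≥ ·)).flatMap fun l => column P y l) ++
  ((List.Ico y (b + 2 - y)).flatMap fun u =>
    column P u b ++ if u + y ≤ b then column P u (b - 1) else []) ++
  ((((levels P).filter (b < ·)).sort (· ≤ ·)).flatMap fun l => column P (l + 1 - y) l)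

/-- The component chain `U_{𝔄,Υ}`, counting from the outside of `U_𝔄`: it is built on the levels
`a_{s+1-Υ}`, `a_{s+1-Υ} - 1`. (With indices `y` starting from `0`, `Υ = y + 1` and `a_{s+1-Υ}` is
`a y.rev`.) Its entries are `v_{𝔄,Υ,1}, v_{𝔄,Υ,2}, …`, in order. -/
def component (P : n.Partition) {s : ℕ} (a : Fin s → ℕ) (y : Fin s) : List (Vertex P) :=
  hookChain P (y + 1) (a y.rev)

/-- The pairs `(Υ, u)` with `1 ≤ Υ ≤ s` and `0 ≤ u < |U_{𝔄,Υ}|`. They index both the elements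
`x^u ⊗ v_{𝔄,Υ,1}` of `T(U_𝔄)` and the vertices `v_{𝔄,Υ,u+1}` of `{U_𝔄}`. -/
abbrev Index (P : n.Partition) {s : ℕ} (a : Fin s → ℕ) :=
  Σ y : Fin s, Fin (component P a y).length

section

variable (P : n.Partition) {s : ℕ} (a : Fin s → ℕ)

/-- `v_{𝔄,Υ,u+1}`. -/
def vertex (r : Index P a) : Vertex P := (component P a r.1).get r.2

/-- `v_{𝔄,Υ,1}`, the initial vertex of the component containing `v_{𝔄,Υ,u+1}`. -/
def start (r : Index P a) : Vertex P := (component P a r.1).get ⟨0, Fin.pos r.2⟩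

/-- The matrix `M_𝔄`: its entry in row `x^u ⊗ v_{𝔄,Υ,1}` and column `v_{𝔄,Υ',u'+1}` is the
coefficient of `A_R^u (v_{𝔄,Υ,1})` on `v_{𝔄,Υ',u'+1}`. -/
noncomputable def matrixM (k : Type*) [Field k] :
    Matrix (Index P a) (Index P a) (MvPolynomial (Var P) k) :=
  Matrix.of fun r c => (simplyAdequate k P ^ (r.2 : ℕ)) (start P a r) (vertex P a c)

/-- The standard chain `v_{𝔄,Υ,1} → v_{𝔄,Υ,2} → ⋯ → v_{𝔄,Υ,u+1}`. -/
def standardChain (r : Index P a) : List (Vertex P) := (component P a r.1).take (r.2 + 1)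

/-- The distinguished monomial `μ_𝔄` (as an exponent vector): the product of the monomials of all
standard chains. -/
noncomputable def distinguished : Var P →₀ ℕ := ∑ r : Index P a, chainMonomial (standardChain P a r)

/-- A chain factorization `(ν, σ, C)` in the expansion of `det M_𝔄`: a permutation `σ` of the
vertices of `U_𝔄`, for each `(Υ, u)` a chain of the augmented diagram with `u + 1` vertices from
`v_{𝔄,Υ,1}` to `σ(v_{𝔄,Υ,u+1})`, and the array of the monomials of these chains. -/
@[ext]
structure ChainFactorization where
  mon : Index P a → (Var P →₀ ℕ)
  perm : Equiv.Perm (Index P a)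
  chain : Index P a → List (Vertex P)
  isChain : ∀ r, (chain r).IsChain (DiagAug P)
  length_eq : ∀ r, (chain r).length = (r.2 : ℕ) + 1
  head_eq : ∀ r, (chain r).head? = some (start P a r)
  last_eq : ∀ r, (chain r).getLast? = some (vertex P a (perm r))
  mon_eq : ∀ r, mon r = chainMonomial (chain r)

variable {P a} in
/-- The monomial (up to sign) of which `f` is a chain factorization: `∏ ν_{Υ,u}`. -/
noncomputable def ChainFactorization.monomial (f : ChainFactorization P a) : Var P →₀ ℕ :=
  ∑ r, f.mon r

end

end MultiUChain

/-!
The proof is an argument by linear programming duality. The vertices `(u, i, k)` get a potential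
`height i u`, and the variables get weights, such that along every edge of the augmented diagram the
potential increases at most by the weight of the variable of the edge (`potential_le`). An edge with
equality is called tight. Two properties make this useful.

* All edges of the component chains are tight (`isChain_component`).
* A vertex of a component has at most one tight edge leaving it (`TightEdge.unique`).

Summed over all chains of a chain factorization, the increments of the potential depend only on the
initial vertices and on the set of final vertices, which is `{U_𝔄}`, and the weights depend only on
the monomial. Hence a factorization of `μ_𝔄` has the same sum of increments and the same sum of
weights as the standard one, where these sums agree; so all its edges are tight
(`ChainFactorization.isChain_tight`), its chains never leave the component in which they start, and
each is an initial segment of that component (`ChainFactorization.eq_standard`). The coefficient of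
`μ_𝔄` in the determinant is the signed number of its chain factorizations, hence `1`.

The potential is given by its increments `slope l v` along a level `l`. They are symmetric about the
middle of the level and grow towards it, until they reach a bound `cap l`. Because of the symmetry
`u ↦ i + 1 - u`, which exchanges left and right hooks, the defect of an edge of `β_i` or `α_i` is in
both cases a difference `height i x - height i⁻ x`, with `x` the distance of the edge from the left,
respectively right, end of its level. Such a step is tight when `x` is small and strict from some
`x` on. The increments near the ends are `2 * foot y - 1`, where `foot y` is the lowest level of the
component `y`, and `cap l` is `2 * l`, lowered to `2 * (l - 1)` if a component alternates between
`l` and `l - 1`; this places the transition from tight to strict exactly where the components turn.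

Maximality is used only to see that the component chains are chains: if the level below `b` does not
occur in `P` and a component has several columns on its level `b`, it moves from column to column by
`w_b`, so `b` has to be in `S_P''` (`apex_mem_oddMins`).
-/

namespace MultiUChain

open Finset MvPolynomial

variable {n : ℕ}

/-! ### The apexes and feet of the components -/

section Potential

variable (P : n.Partition) {s : ℕ} (a : Fin s → ℕ)

lemma levels_pos {l : ℕ} (h : l ∈ levels P) : 1 ≤ l :=
  P.parts_pos (Multiset.mem_toFinset.1 h)

lemma levels_le {l : ℕ} (h : l ∈ levels P) : l ≤ n :=
  P.le_of_mem_parts (Multiset.mem_toFinset.1 h)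

lemma mult_pos {l : ℕ} (h : l ∈ levels P) : 1 ≤ mult P l :=
  Multiset.count_pos.2 (Multiset.mem_toFinset.1 h)

/-- The upper level `b` of the two levels `b`, `b - 1` on which the component with index `y`
(counted from the outside, from `0`) is built. The sequence is continued for `y ≥ s` by values
beyond all levels, so that statements about `apex (y + 1)` need no case distinction. -/
def apex (n : ℕ) {s : ℕ} (a : Fin s → ℕ) (y : ℕ) : ℕ :=
  if h : y < s then a (Fin.rev ⟨y, h⟩) else 2 * n + 2 * y + 1

/-- The component with index `y` really alternates between the levels `b` and `b - 1`: the level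
`b - 1` is occupied and the component has more than one column on level `b`. -/
def Paired (y : ℕ) : Prop := apex n a y - 1 ∈ levels P ∧ 2 * y + 2 ≤ apex n a y

open Classical in
/-- The lowest level met by the component with index `y`. -/
noncomputable def foot (y : ℕ) : ℕ :=
  if Paired P a y then apex n a y - 1 else apex n a y

open Classical in
/-- An upper bound for the slopes of the potential on level `l`. It is twice the level, except that
the two levels of a paired component get the same bound. -/
noncomputable def cap (l : ℕ) : ℕ :=
  if ∃ y, Paired P a y ∧ l = apex n a y then 2 * (l - 1) else 2 * l

/-- The increment of the potential between the columns `v` and `v + 1` of level `l`, where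
`0 ≤ v ≤ l`. It is symmetric under `v ↦ l - v`. -/
noncomputable def slope (l v : ℕ) : ℕ := min (2 * foot P a (min v (l - v)) - 1) (cap P a l)

/-- The potential of the vertices in column `x` of level `l`. The sum starts from the virtual column
`0`: its increment makes the steps below the outermost component strict. -/
noncomputable def height (l x : ℕ) : ℕ := ∑ v ∈ range x, slope P a l v

variable {P a}

lemma IsUTuple.add_le (ha : IsUTuple P a) (d : ℕ) (i j : Fin s) (h : (i : ℕ) + d = j) :
    a j + 2 * d ≤ a i := by
  induction d generalizing j with
  | zero =>
    have : i = j := Fin.ext (by omega)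
    subst this; omega
  | succ d ih =>
    have h1 := ih ⟨i + d, by omega⟩ rfl
    have h2 := ha.gap ⟨i + d, by omega⟩ j (by simp only; omega)
    omega

lemma apex_eq (y : Fin s) : apex n a y = a y.rev := by simp [apex]

lemma apex_mem (ha : IsUTuple P a) {y : ℕ} (h : y < s) : apex n a y ∈ levels P := by
  rw [apex, dif_pos h]; exact ha.mem _

lemma apex_succ (ha : IsUTuple P a) (y : ℕ) :
    apex n a y + 2 ≤ apex n a (y + 1) := by
  by_cases h : y + 1 < s
  · rw [apex, apex, dif_pos h, dif_pos (by omega)]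
    exact ha.gap _ _ (by simp only [Fin.val_rev]; omega)
  · by_cases h' : y < s
    · have := levels_le P (apex_mem ha h')
      have h3 : apex n a (y + 1) = 2 * n + 2 * (y + 1) + 1 := dif_neg h
      omega
    · have h3 : apex n a (y + 1) = 2 * n + 2 * (y + 1) + 1 := dif_neg h
      have h4 : apex n a y = 2 * n + 2 * y + 1 := dif_neg h'
      omega

lemma apex_add_two_le (ha : IsUTuple P a) {y z : ℕ} (h : y < z) :
    apex n a y + 2 ≤ apex n a z := by
  induction z, h using Nat.le_induction with
  | base => exact apex_succ ha y
  | succ z _ ih => have := apex_succ ha z; omega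

lemma two_mul_lt_apex (ha : IsUTuple P a) (y : ℕ) : 2 * y + 1 ≤ apex n a y := by
  induction y with
  | zero =>
    by_cases h : 0 < s
    · exact levels_pos P (apex_mem ha h)
    · rw [apex, dif_neg h]; omega
  | succ y ih => have := apex_succ ha y; omega

lemma apex_injective (ha : IsUTuple P a) {y z : ℕ}
    (h : apex n a y = apex n a z) : y = z := by
  rcases lt_trichotomy y z with h' | h' | h'
  · have := apex_add_two_le ha h'; omega
  · exact h'
  · have := apex_add_two_le ha h'; omega

lemma foot_of_paired {y : ℕ} (h : Paired P a y) : foot P a y = apex n a y - 1 := if_pos h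

lemma foot_of_not_paired {y : ℕ} (h : ¬ Paired P a y) : foot P a y = apex n a y := if_neg h

lemma foot_le_apex (y : ℕ) : foot P a y ≤ apex n a y := by
  unfold foot; split_ifs <;> omega

lemma apex_le_foot_succ (y : ℕ) : apex n a y ≤ foot P a y + 1 := by
  unfold foot; split_ifs <;> omega

lemma two_mul_lt_foot (ha : IsUTuple P a) (y : ℕ) : 2 * y + 1 ≤ foot P a y := by
  have := two_mul_lt_apex ha y
  by_cases h : Paired P a y
  · rw [foot_of_paired h]; have := h.2; omega
  · rwa [foot_of_not_paired h]

lemma apex_lt_foot (ha : IsUTuple P a) {y z : ℕ} (h : y < z) :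
    apex n a y < foot P a z := by
  have := apex_add_two_le ha h
  have := apex_le_foot_succ (P := P) (a := a) z
  omega

lemma foot_mono (ha : IsUTuple P a) {y z : ℕ} (h : y ≤ z) : foot P a y ≤ foot P a z := by
  rcases h.eq_or_lt with rfl | h
  · rfl
  · exact (foot_le_apex y).trans (apex_lt_foot ha h).le

lemma foot_lt (ha : IsUTuple P a) {y z : ℕ} (h : y < z) : foot P a y < foot P a z :=
  (foot_le_apex y).trans_lt (apex_lt_foot ha h)

lemma cap_le (l : ℕ) : cap P a l ≤ 2 * l := by unfold cap; split_ifs <;> omega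

lemma le_cap (l : ℕ) : 2 * (l - 1) ≤ cap P a l := by unfold cap; split_ifs <;> omega

lemma cap_apex (ha : IsUTuple P a) (y : ℕ) : cap P a (apex n a y) = 2 * foot P a y := by
  by_cases h : Paired P a y
  · rw [cap, if_pos ⟨y, h, rfl⟩, foot_of_paired h]
  · rw [cap, if_neg, foot_of_not_paired h]
    rintro ⟨z, hz, e⟩
    exact h (apex_injective ha e ▸ hz)

lemma cap_foot (ha : IsUTuple P a) (y : ℕ) : cap P a (foot P a y) = 2 * foot P a y := by
  by_cases h : Paired P a y
  · rw [cap, if_neg]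
    rintro ⟨z, hz, e⟩
    rw [foot_of_paired h] at e
    have := h.2
    rcases lt_trichotomy y z with h' | rfl | h'
    · have := apex_add_two_le ha h'; omega
    · omega
    · have := apex_add_two_le ha h'; omega
  · conv_lhs => rw [foot_of_not_paired h]
    exact cap_apex ha y

lemma cap_mono {l m : ℕ} (h : l < m) : cap P a l ≤ cap P a m := by
  have := cap_le (P := P) (a := a) l
  have := le_cap (P := P) (a := a) m
  omega

/-- Only the two levels of a paired component have the same slope bound. -/
lemma cap_lt {l m : ℕ} (h : l < m)
    (hm : ∀ y, Paired P a y → m = apex n a y → l ≠ foot P a y) :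
    cap P a l < cap P a m := by
  have := cap_le (P := P) (a := a) l
  by_cases hp : ∃ y, Paired P a y ∧ m = apex n a y
  · obtain ⟨y, hy, e⟩ := hp
    have := hm y hy e
    rw [foot_of_paired hy] at this
    rw [cap.eq_def P a m, if_pos ⟨y, hy, e⟩]
    omega
  · rw [cap.eq_def P a m, if_neg hp]; omega

lemma slope_mono (ha : IsUTuple P a) {l m : ℕ} (h : l < m) (v : ℕ) :
    slope P a l v ≤ slope P a m v := by
  have := foot_mono ha (y := min v (l - v)) (z := min v (m - v)) (by omega)
  have := cap_mono (P := P) (a := a) h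
  unfold slope
  omega

lemma height_mono (ha : IsUTuple P a) {l m : ℕ} (h : l < m) (x : ℕ) :
    height P a l x ≤ height P a m x :=
  Finset.sum_le_sum fun v _ => slope_mono ha h v

lemma height_lt (ha : IsUTuple P a) {l m v x : ℕ} (h : l < m) (hv : v < x)
    (hs : slope P a l v < slope P a m v) : height P a l x < height P a m x :=
  Finset.sum_lt_sum (fun v _ => slope_mono ha h v) ⟨v, mem_range.2 hv, hs⟩

/-- The potential increments of a level are symmetric about its middle. -/
lemma height_add_height (l x : ℕ) (h : x ≤ l + 1) :
    height P a l x + height P a l (l + 1 - x) = height P a l (l + 1) := by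
  have h1 : height P a l (l + 1) =
      height P a l x + ∑ v ∈ range (l + 1 - x), slope P a l (x + v) := by
    rw [height, height, ← Finset.sum_range_add, Nat.add_sub_cancel' h]
  rw [h1, height, height, ← Finset.sum_range_reflect (fun v => slope P a l v) (l + 1 - x)]
  congr 1
  refine Finset.sum_congr rfl fun v hv => ?_
  rw [mem_range] at hv
  unfold slope
  rw [show min (l + 1 - x - 1 - v) (l - (l + 1 - x - 1 - v)) = min (x + v) (l - (x + v)) by omega]

/-! ### Comparison of the potential on two levels -/

/-- On the left hook of the component `y`, steps down are tight. -/
lemma height_eq_of_apex_le (ha : IsUTuple P a) {y l m x : ℕ} (hl : apex n a y ≤ l)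
    (h : l < m) (hx : x ≤ y + 1) : height P a l x = height P a m x := by
  refine Finset.sum_congr rfl fun v hv => ?_
  rw [mem_range] at hv
  have := two_mul_lt_apex ha y
  have h1 := foot_mono ha (show v ≤ y by omega)
  have h2 : 2 * foot P a y ≤ cap P a l := by
    rcases hl.eq_or_lt with rfl | hl
    · exact (cap_apex ha y).ge
    · have := foot_le_apex (P := P) (a := a) y
      have := le_cap (P := P) (a := a) l
      omega
  have h3 := cap_mono (P := P) (a := a) h
  unfold slope
  rw [show min v (l - v) = v by omega, show min v (m - v) = v by omega]
  omega

/-- Between the two levels of a paired component, steps are tight up to the right hook. -/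
lemma height_eq_of_paired (ha : IsUTuple P a) {y x : ℕ} (hp : Paired P a y)
    (hx : x + y + 1 ≤ apex n a y) :
    height P a (apex n a y - 1) x = height P a (apex n a y) x := by
  refine Finset.sum_congr rfl fun v hv => ?_
  rw [mem_range] at hv
  have h2 := hp.2
  have h1 := cap_apex ha y
  have h3 := cap_foot ha y
  have h4 := foot_of_paired hp
  rw [h4] at h3 h1
  unfold slope
  rw [h1, h3]
  by_cases hv' : v ≤ apex n a y - 1 - v
  · rw [show min v (apex n a y - 1 - v) = v by omega,
      show min v (apex n a y - v) = v by omega]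
  · have h5 := apex_lt_foot ha (show y < min v (apex n a y - 1 - v) by omega)
    have h6 := apex_lt_foot ha (show y < min v (apex n a y - v) by omega)
    omega

/-- Inside the component `y`, steps below its foot are not tight. -/
lemma height_lt_foot (ha : IsUTuple P a) {y l x : ℕ} (hl : l < foot P a y) (hx : y + 1 ≤ x) :
    height P a l x < height P a (foot P a y) x := by
  refine height_lt ha hl (v := y) (by omega) ?_
  have := two_mul_lt_foot ha y
  have := cap_le (P := P) (a := a) l
  have := cap_foot ha y
  unfold slope
  rw [show min y (foot P a y - y) = y by omega]
  omega

/-- The component `y` cannot leave its upper level upwards before it reaches its right hook. -/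
lemma height_apex_lt (ha : IsUTuple P a) {y m x : ℕ} (hm : apex n a y < m)
    (h2 : 2 * y + 2 ≤ apex n a y) (hx : y + 2 ≤ x) :
    height P a (apex n a y) x < height P a m x := by
  refine height_lt ha hm (v := y + 1) (by omega) ?_
  have h3 : cap P a (apex n a y) < cap P a m := by
    refine cap_lt hm fun z hz e h => ?_
    have := foot_of_paired hz
    rcases lt_trichotomy y z with h' | rfl | h'
    · have := apex_lt_foot ha h'; omega
    · omega
    · have := apex_add_two_le ha h'; omega
  have h4 := cap_le (P := P) (a := a) (apex n a y)
  have h5 := apex_lt_foot ha (show y < y + 1 by omega)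
  unfold slope
  rw [show min (y + 1) (m - (y + 1)) = y + 1 by omega]
  omega

/-- On the left hook of the component `y`, steps up are not tight. -/
lemma height_lt_of_left (ha : IsUTuple P a) {y l m : ℕ} (hl : apex n a y < l)
    (h : l < m) : height P a l (l - y) < height P a m (l - y) := by
  have hb := two_mul_lt_apex ha y
  refine height_lt ha h (v := l - y - 1) (by omega) ?_
  unfold slope
  rw [show min (l - y - 1) (l - (l - y - 1)) = y + 1 by omega]
  have h3 := foot_mono ha (show y + 1 ≤ min (l - y - 1) (m - (l - y - 1)) by omega)
  have h4 := cap_mono (P := P) (a := a) h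
  have h6 := cap_le (P := P) (a := a) l
  have h7 := two_mul_lt_foot ha (y + 1)
  by_cases hc : l < foot P a (y + 1)
  · have h5 : cap P a l < cap P a m := by
      refine cap_lt h fun z hz e h => ?_
      have := foot_of_paired hz
      rcases lt_or_ge y z with h' | h'
      · have := foot_mono ha (show y + 1 ≤ z by omega); omega
      · rcases h'.eq_or_lt with rfl | h'
        · omega
        · have := apex_add_two_le ha h'; omega
    omega
  · -- here the level is at least `foot (y + 1) ≥ 2 * y + 3`, so the slope on level `m` is
    -- governed by a later foot
    have h5 := foot_lt ha (show y + 1 < min (l - y - 1) (m - (l - y - 1)) by omega)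
    have h8 : 2 * foot P a (y + 1) ≤ cap P a l := by
      rcases (not_lt.1 hc).eq_or_lt with e | e
      · rw [← e, cap_foot ha]
      · have := le_cap (P := P) (a := a) l; omega
    omega

/-- On the right hook of the component `y`, steps down are not tight. -/
lemma height_lt_of_right (ha : IsUTuple P a) {y l m : ℕ} (hm : apex n a y ≤ m)
    (hm' : 2 * y + 2 ≤ m) (h : l < m) :
    height P a l (m - y) < height P a m (m - y) := by
  refine height_lt ha h (v := m - y - 1) (by omega) ?_
  have h3 := foot_mono ha (show min (m - y - 1) (l - (m - y - 1)) ≤ y by omega)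
  have h4 := foot_lt ha (show y < y + 1 by omega)
  have h5 : 2 * foot P a y ≤ cap P a m := by
    rcases hm.eq_or_lt with e | e
    · rw [← e, cap_apex ha]
    · have := foot_le_apex (P := P) (a := a) y
      have := le_cap (P := P) (a := a) m
      omega
  have h6 := two_mul_lt_foot ha y
  unfold slope
  rw [show min (m - y - 1) (m - (m - y - 1)) = y + 1 by omega]
  omega

/-- Between the hooks of an unpaired component, the steps of the map `w` of its apex are tight. -/
lemma slope_apex (ha : IsUTuple P a) {y u : ℕ} (hp : ¬ Paired P a y) (h1 : y + 1 ≤ u)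
    (h2 : u + y + 1 ≤ apex n a y) :
    slope P a (apex n a y) u = 2 * apex n a y := by
  have := cap_apex ha y
  rw [foot_of_not_paired hp] at this
  have := apex_lt_foot ha (show y < min u (apex n a y - u) by omega)
  unfold slope
  omega

end Potential

/-! ### Weights of variables and tight edges -/

section Weights

variable {P : n.Partition} {s : ℕ} {a : Fin s → ℕ}

lemma pred_spec {i : ℕ} (hi : i ∈ (levels P).filter fun i => ∃ j ∈ levels P, j < i) :
    pred P i ∈ levels P ∧ pred P i < i ∧ ∀ j ∈ levels P, j < i → j ≤ pred P i := by
  obtain ⟨j, hj, hji⟩ := (mem_filter.1 hi).2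
  have hne : ((levels P).filter (· < i)).Nonempty := ⟨j, mem_filter.2 ⟨hj, hji⟩⟩
  obtain ⟨m, hm, e⟩ := Finset.exists_mem_eq_sup _ hne id
  have hm' := mem_filter.1 hm
  refine ⟨?_, ?_, fun j hj hji => ?_⟩
  · rw [pred, e]; exact hm'.1
  · rw [pred, e]; exact hm'.2
  · exact Finset.le_sup (f := id) (mem_filter.2 ⟨hj, hji⟩)

lemma pred_injective {i j : NonMin P} (h : pred P i = pred P j) : i = j := by
  obtain ⟨_, h2, h3⟩ := pred_spec i.2
  obtain ⟨_, h5, h6⟩ := pred_spec j.2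
  have hi := (mem_filter.1 i.2).1
  have hj := (mem_filter.1 j.2).1
  refine Subtype.ext ?_
  rcases lt_trichotomy (i : ℕ) j with h' | h' | h'
  · have := h6 _ hi h'; omega
  · exact h'
  · have := h3 _ hj h'; omega

/-- An edge of the augmented diagram comes from exactly one of the maps. -/
lemma Maps.label_unique {γ γ' : Var P} {v v' : Vertex P} (h : Maps γ v v') (h' : Maps γ' v v') :
    γ = γ' := by
  rcases γ with i | i | ⟨j, k⟩ | l <;> rcases γ' with i' | i' | ⟨j', k'⟩ | l' <;>
    simp only [Maps] at h h'
  · rw [Subtype.ext (h.1.symm.trans h'.1)]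
  · have := (pred_spec i.2).2.1; have := (pred_spec i'.2).2.1; omega
  · have := (pred_spec i.2).2.1; omega
  · have := (pred_spec i.2).2.1; omega
  · have := (pred_spec i.2).2.1; have := (pred_spec i'.2).2.1; omega
  · rw [Subtype.ext (h.2.2.2.1.symm.trans h'.2.2.2.1)]
  · have := (pred_spec i.2).2.1; omega
  · have := (pred_spec i.2).2.1; omega
  · have := (pred_spec i'.2).2.1; omega
  · have := (pred_spec i'.2).2.1; omega
  · obtain rfl : j = j' := Subtype.ext (h.1.symm.trans h'.1)
    rw [Subtype.ext (h.2.1.symm.trans h'.2.1)]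
  · omega
  · have := (pred_spec i'.2).2.1; omega
  · have := (pred_spec i'.2).2.1; omega
  · omega
  · rw [Subtype.ext (h.1.symm.trans h'.1)]

variable (a) in
/-- The potential of a vertex. -/
noncomputable def potential (v : Vertex P) : ℤ := height P a v.i v.u

variable (P a) in
open Classical in
/-- The weight of a variable: an upper bound for the increments of the potential along the edges
labelled by it. The bound for `z_l` is attained only if `l` is an apex. -/
noncomputable def weight : Var P → ℤ
  | .s _ => 0
  | .t i => height P a i (i + 1) - height P a (pred P i) (pred P i + 1)
  | .e _ _ => 0
  | .z l => if ∃ y, (l : ℕ) = apex n a y then 2 * (l : ℤ) else 2 * (l : ℤ) + 1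

lemma potential_t {i : NonMin P} {v v' : Vertex P} (h : Maps (.t i) v v') :
    potential a v + weight P a (.t i) - potential a v' =
      height P a i (v.i + 1 - v.u) - height P a (pred P i) (v.i + 1 - v.u) := by
  obtain ⟨h1, h2, h3, h4, h5⟩ := h
  have := (pred_spec i.2).2.1
  have := v.u_le
  have e1 := height_add_height (P := P) (a := a) (pred P i) v.u (by omega)
  have e2 := height_add_height (P := P) (a := a) i v'.u (by omega)
  rw [show (i : ℕ) + 1 - v'.u = v.i + 1 - v.u by omega] at e2
  rw [← h1] at e1
  simp only [potential, weight, h4, ← h1]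
  omega

lemma potential_z {l : {l // l ∈ oddMins P}} {v v' : Vertex P} (h : Maps (.z l) v v') :
    potential a v' = potential a v + slope P a l v.u := by
  obtain ⟨h1, h2, h3, h4, h5⟩ := h
  simp only [potential, h3, h4, h1, height, sum_range_succ]
  push_cast
  ring

/-- Along an edge the potential increases at most by the weight of its label. -/
lemma potential_le (ha : IsUTuple P a) {γ : Var P} {v v' : Vertex P} (h : Maps γ v v') :
    potential a v' ≤ potential a v + weight P a γ := by
  rcases γ with i | i | ⟨j, k⟩ | l
  · have := height_mono ha (pred_spec i.2).2.1 v.u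
    simp only [potential, weight, h.1, h.2.2.1, h.2.2.2.1]
    omega
  · have := potential_t (a := a) h
    have := height_mono ha (pred_spec i.2).2.1 (v.i + 1 - v.u)
    omega
  · simp [potential, weight, h.1, h.2.2.1, h.2.2.2.1]
  · rw [potential_z h]
    have h1 : slope P a l v.u ≤ 2 * l := (min_le_right _ _).trans (cap_le _)
    simp only [weight]
    split_ifs <;> omega

variable (a) in
/-- An edge is tight when the potential increases along it by the full weight of its label. -/
def TightEdge (v v' : Vertex P) : Prop :=
  ∃ γ : Var P, Maps γ v v' ∧ potential a v' = potential a v + weight P a γ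

variable (a) in
/-- The region of the component with index `y`: its left and right hooks, and the columns between
them on its two lowest levels. -/
def InComponent (y : ℕ) (v : Vertex P) : Prop :=
  (apex n a y < v.i ∧ (v.u = y + 1 ∨ v.u + y = v.i)) ∨
  (v.i = apex n a y ∧ y + 1 ≤ v.u ∧ v.u + y ≤ v.i) ∨
  (v.i + 1 = apex n a y ∧ y + 1 ≤ v.u ∧ v.u + y ≤ v.i)

lemma paired_of_inComponent {y : ℕ} {v : Vertex P} (h : InComponent a y v)
    (hv : v.i + 1 = apex n a y) : Paired P a y := by
  refine ⟨?_, ?_⟩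
  · rw [← hv]; exact v.i_mem
  · rcases h with h | h | h <;> omega

lemma tight_s (ha : IsUTuple P a) {y : ℕ} {i : NonMin P} {v v' : Vertex P}
    (hv : InComponent a y v) (h : Maps (.s i) v v')
    (ht : potential a v' = potential a v + weight P a (.s i)) :
    (apex n a y < v.i ∧ v.u = y + 1) ∨
      (v.i = apex n a y ∧ Paired P a y ∧ v.u + y + 1 ≤ v.i) := by
  obtain ⟨h1, h2, h3, h4, h5⟩ := h
  have hp := (pred_spec i.2).2.1
  have hb := two_mul_lt_apex ha y
  simp only [potential, weight, h3, h4, ← h1] at ht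
  rw [← h1] at hp
  have hright : v.u + y = v.i → 2 * y + 2 ≤ v.i → apex n a y ≤ v.i → False := by
    intro e e1 e2
    have := height_lt_of_right ha e2 e1 hp
    rw [show v.i - y = v.u by omega] at this
    omega
  have hfoot : v.i = foot P a y → y + 1 ≤ v.u → False := by
    intro e e'
    have := height_lt_foot ha (hp.trans_eq e) e'
    rw [← e] at this
    omega
  rcases hv with ⟨hv, hu | hu⟩ | ⟨hv, hu1, hu2⟩ | ⟨hv, hu1, hu2⟩
  · exact Or.inl ⟨hv, hu⟩
  · exact (hright hu (by omega) hv.le).elim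
  · by_cases hpr : Paired P a y
    · refine Or.inr ⟨hv, hpr, ?_⟩
      have := hpr.2
      by_contra hc
      exact hright (by omega) (by omega) hv.ge
    · exact (hfoot (by rw [foot_of_not_paired hpr, hv]) hu1).elim
  · refine (hfoot ?_ hu1).elim
    rw [foot_of_paired (paired_of_inComponent (Or.inr (Or.inr ⟨hv, hu1, hu2⟩)) hv)]
    omega

lemma tight_t (ha : IsUTuple P a) {y : ℕ} {i : NonMin P} {v v' : Vertex P}
    (hv : InComponent a y v) (h : Maps (.t i) v v')
    (ht : potential a v' = potential a v + weight P a (.t i)) :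
    (apex n a y ≤ v.i ∧ v.u + y = v.i) ∨ v.i + 1 = apex n a y := by
  have hpt := potential_t (a := a) h
  obtain ⟨h1, h2, h3, h4, h5⟩ := h
  have hp := (pred_spec i.2).2.1
  have hb := two_mul_lt_apex ha y
  rw [← h1] at hp hpt
  rcases hv with ⟨hv, hu | hu⟩ | ⟨hv, hu1, hu2⟩ | ⟨hv, hu1, hu2⟩
  · have := height_lt_of_left ha hv hp
    rw [show v.i - y = v.i + 1 - v.u by omega] at this
    omega
  · exact Or.inl ⟨hv.le, hu⟩
  · refine Or.inl ⟨hv.ge, ?_⟩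
    by_contra hc
    have := height_apex_lt ha (x := v.i + 1 - v.u) (hv ▸ hp) (by omega) (by omega)
    rw [← hv] at this
    omega
  · exact Or.inr hv

lemma tight_z (ha : IsUTuple P a) {y : ℕ} {l : {l // l ∈ oddMins P}} {v v' : Vertex P}
    (hv : InComponent a y v) (h : Maps (.z l) v v')
    (ht : potential a v' = potential a v + weight P a (.z l)) :
    v.i = apex n a y ∧ ¬ Paired P a y ∧ v.u + y + 1 ≤ v.i := by
  rw [potential_z h] at ht
  obtain ⟨h1, h2, h3, h4, h5⟩ := h
  have hb := two_mul_lt_apex ha y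
  have h6 : slope P a l v.u ≤ cap P a l := min_le_right _ _
  have h7 := cap_le (P := P) (a := a) l
  rw [← h1] at h6 h7 ht
  -- only the variables of the apexes have a weight that a slope can reach
  obtain ⟨z, hz⟩ : ∃ z, v.i = apex n a z := by
    by_contra hc
    have hw : weight P a (.z l) = 2 * (l : ℤ) + 1 := if_neg (by rwa [← h1])
    omega
  have hs : slope P a v.i v.u = 2 * v.i := by
    have hw : weight P a (.z l) = 2 * (l : ℤ) := if_pos ⟨z, by rwa [← h1]⟩
    omega
  have hzp : ¬ Paired P a z := by
    intro hp
    have := cap_apex ha z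
    have := foot_of_paired hp
    have := hp.2
    rw [hz] at hs h6
    omega
  have hu := v.one_le_u
  have hu' := v'.u_le
  -- the slope is at most twice the foot of the component with index `min u (i - u)`, minus one
  have h8 : z < min v.u (v.i - v.u) := by
    by_contra hc
    have h9 := foot_mono ha (not_lt.1 hc)
    rw [foot_of_not_paired hzp, ← hz] at h9
    have h10 : slope P a v.i v.u ≤ 2 * foot P a (min v.u (v.i - v.u)) - 1 := min_le_left _ _
    omega
  have hzy : z = y := by
    rcases lt_trichotomy z y with h' | h' | h'
    · have := apex_add_two_le ha h'
      rcases hv with hv | hv | hv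
      · omega
      · omega
      · have := paired_of_inComponent (Or.inr (Or.inr hv)) hv.1
        omega
    · exact h'
    · rcases hv with hv | hv | hv
      · omega
      · have := apex_add_two_le ha h'; omega
      · have := apex_add_two_le ha h'; omega
  subst hzy
  exact ⟨hz, hzp, by omega⟩

lemma Maps.k_lt {j : {j // j ∈ levels P}} {k : {k // k ∈ Ico 1 (mult P j)}} {v v' : Vertex P}
    (h : Maps (.e j k) v v') : v.k < mult P v.i := by
  have h1 := (mem_Ico.1 k.2).2
  have h2 : v.i = j := h.1
  have h3 : v.k = k := h.2.1
  rwa [h2, h3]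

lemma Maps.k_eq {γ : Var P} {v v' : Vertex P} (h : Maps γ v v') (hγ : ∀ j k, γ ≠ .e j k) :
    v.k = mult P v.i := by
  rcases γ with i | i | ⟨j, k⟩ | l
  · rw [h.1]; exact h.2.1
  · rw [h.1]; exact h.2.1
  · exact absurd rfl (hγ _ _)
  · rw [h.1]; exact h.2.1

/-- A vertex of a component has at most one tight edge leaving it. -/
lemma TightEdge.unique (ha : IsUTuple P a) {y : ℕ} {v v₁ v₂ : Vertex P}
    (hv : InComponent a y v) (h₁ : TightEdge a v v₁) (h₂ : TightEdge a v v₂) : v₁ = v₂ := by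
  obtain ⟨γ, h, ht⟩ := h₁
  obtain ⟨γ', h', ht'⟩ := h₂
  have hb := two_mul_lt_apex ha y
  have key : γ = γ' := by
    rcases γ with i | i | ⟨j, k⟩ | l <;> rcases γ' with i' | i' | ⟨j', k'⟩ | l'
    · rw [Subtype.ext (h.1.symm.trans h'.1)]
    · have := tight_s ha hv h ht
      have := tight_t ha hv h' ht'
      omega
    · exact absurd (h.k_eq (by simp)) h'.k_lt.ne
    · rcases tight_z ha hv h' ht' with ⟨h1, h2, h3⟩
      rcases tight_s ha hv h ht with h4 | h4
      · omega
      · exact (h2 h4.2.1).elim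
    · have := tight_s ha hv h' ht'
      have := tight_t ha hv h ht
      omega
    · rw [pred_injective (h.1.symm.trans h'.1)]
    · exact absurd (h.k_eq (by simp)) h'.k_lt.ne
    · have := tight_t ha hv h ht
      have := tight_z ha hv h' ht'
      omega
    · exact absurd (h'.k_eq (by simp)) h.k_lt.ne
    · exact absurd (h'.k_eq (by simp)) h.k_lt.ne
    · obtain rfl : j = j' := Subtype.ext (h.1.symm.trans h'.1)
      rw [Subtype.ext (h.2.1.symm.trans h'.2.1)]
    · exact absurd (h'.k_eq (by simp)) h.k_lt.ne
    · rcases tight_z ha hv h ht with ⟨h1, h2, h3⟩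
      rcases tight_s ha hv h' ht' with h4 | h4
      · omega
      · exact (h2 h4.2.1).elim
    · have := tight_t ha hv h' ht'
      have := tight_z ha hv h ht
      omega
    · exact absurd (h.k_eq (by simp)) h'.k_lt.ne
    · rw [Subtype.ext (h.1.symm.trans h'.1)]
  subst key
  rcases γ with i | i | ⟨j, k⟩ | l <;> obtain ⟨_, _, e1, e2, e3⟩ := h <;>
    obtain ⟨_, _, e1', e2', e3'⟩ := h' <;> refine Vertex.ext ?_ ?_ ?_ <;> omega

end Weights

/-! ### Maximality puts unpaired apexes into `S_P''` -/

section Maximality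

variable {P : n.Partition} {s : ℕ} {a : Fin s → ℕ}

lemma IsUTuple.eq_of_close (ha : IsUTuple P a) {i j : Fin s} (h : a i ≤ a j + 1)
    (h' : a j ≤ a i + 1) : i = j := by
  rcases lt_trichotomy (i : ℕ) j with hij | hij | hij
  · have := ha.add_le (j - i) i j (by omega); omega
  · exact Fin.ext hij
  · have := ha.add_le (i - j) j i (by omega); omega

/-- If `b, b + 2, …, b + 2 * j` are entries of a maximal tuple, `b - 1` is not a level, and
`b + 1, b + 3, …, b + 2 * j + 1` are levels, then `b + 2 * j + 2` is an entry as well: otherwise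
these entries could be increased by one. -/
lemma exists_eq_of_maximal (ha : IsMaximalUTuple P a) {b j : ℕ} {i₀ : Fin s} (hi₀ : a i₀ = b)
    (hs : 2 * (s - i₀) ≤ b) (hb : b - 1 ∉ levels P) (hj : ∀ m ≤ j, ∃ i, a i = b + 2 * m)
    (hl : ∀ m ≤ j, b + 2 * m + 1 ∈ levels P) : ∃ i, a i = b + 2 * j + 2 := by
  by_contra hne
  have hne' : ∀ i, a i ≠ b + 2 * j + 2 := fun i h => hne ⟨i, h⟩
  have hT := ha.1
  have hpar : ∀ i, b ≤ a i → a i ≤ b + 2 * j → ∃ m ≤ j, a i = b + 2 * m := by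
    intro i h1 h2
    obtain ⟨i', hi'⟩ := hj ((a i - b) / 2) (by omega)
    have : i = i' := hT.eq_of_close (by omega) (by omega)
    subst this
    exact ⟨_, by omega, hi'⟩
  let a' : Fin s → ℕ := fun i => if b ≤ a i ∧ a i ≤ b + 2 * j then a i + 1 else a i
  have hin : ∀ i, b ≤ a i → a i ≤ b + 2 * j → a' i = a i + 1 := fun i h1 h2 => if_pos ⟨h1, h2⟩
  have hout : ∀ i, ¬ (b ≤ a i ∧ a i ≤ b + 2 * j) → a' i = a i := fun i h => if_neg h
  have ha' : IsUTuple P a' := by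
    constructor
    · intro i
      by_cases h : b ≤ a i ∧ a i ≤ b + 2 * j
      · obtain ⟨m, hm, e⟩ := hpar i h.1 h.2
        rw [hin i h.1 h.2, e]
        exact hl m hm
      · rw [hout i h]; exact hT.mem i
    · intro i i' hii
      have hg := hT.gap i i' hii
      by_cases h' : b ≤ a i' ∧ a i' ≤ b + 2 * j
      · obtain ⟨m', hm', e'⟩ := hpar i' h'.1 h'.2
        rw [hin i' h'.1 h'.2]
        by_cases h : b ≤ a i ∧ a i ≤ b + 2 * j
        · rw [hin i h.1 h.2]; omega
        · rw [hout i h]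
          have := hne' i
          omega
      · rw [hout i' h']
        by_cases h : b ≤ a i ∧ a i ≤ b + 2 * j
        · rw [hin i h.1 h.2]; omega
        · rw [hout i h]; exact hg
  -- the new levels cover the old ones, apart from the unoccupied level `b - 1`
  have hcover : ∀ l, b ≤ l → l ≤ b + 2 * j + 1 → InLevels a' l := by
    intro l h1 h2
    obtain ⟨i, hi⟩ := hj ((l - b) / 2) (by omega)
    refine ⟨i, ?_⟩
    rw [hin i (by omega) (by omega)]
    omega
  have hlev : ∀ l ∈ levels P, InLevels a l → InLevels a' l := by
    intro l hlP ⟨i, hi⟩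
    have : l ≠ b - 1 := fun h => hb (h ▸ hlP)
    by_cases h : b ≤ a i ∧ a i ≤ b + 2 * j
    · exact hcover l (by omega) (by omega)
    · exact ⟨i, by rw [hout i h]; exact hi⟩
  have hlt : ∀ l, ¬ (b ≤ l ∧ l ≤ b + 2 * j + 1) → ∀ i, a' i < l ↔ a i < l := by
    intro l hl' i
    by_cases h : b ≤ a i ∧ a i ≤ b + 2 * j
    · rw [hin i h.1 h.2]; omega
    · rw [hout i h]
  refine ha.2 a' ha' ⟨?_, ?_⟩
  · rintro v (hv | ⟨hv, ⟨i, hi⟩, hu⟩)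
    · exact Or.inl (hlev _ v.i_mem hv)
    · by_cases hv' : InLevels a' v.i
      · exact Or.inl hv'
      · have hrange : ¬ (b ≤ v.i ∧ v.i ≤ b + 2 * j + 1) := fun h => hv' (hcover _ h.1 h.2)
        have hnum : numBelow a' v.i = numBelow a v.i := by
          unfold numBelow
          congr 1
          exact Finset.filter_congr fun i _ => hlt _ hrange i
        refine Or.inr ⟨hv', ⟨i, (hlt _ hrange i).2 hi⟩, ?_⟩
        rwa [hnum]
  · intro hsub
    -- a vertex of the level `b + 2 * j + 1` strictly between the hooks
    have hcount : numBelow a (b + 2 * j + 1) ≤ s - i₀ + j := by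
      obtain ⟨i₁, hi₁⟩ := hj j le_rfl
      have h1 : numBelow a (b + 2 * j + 1) ≤ (Finset.Ici i₁).card := by
        refine Finset.card_le_card fun i hi => ?_
        rw [mem_filter] at hi
        rw [mem_Ici]
        by_contra hc
        have hc' : (i : ℕ) < i₁ := by simpa using hc
        have := hT.add_le (i₁ - i) i i₁ (by omega)
        omega
      rw [Fin.card_Ici] at h1
      have h2 : (i₀ : ℕ) ≤ i₁ + j := by
        by_contra hc
        have := hT.add_le (i₀ - i₁) i₁ i₀ (by omega)
        omega
      have := i₀.2
      omega
    have hmem := hl j le_rfl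
    let v : Vertex P := ⟨numBelow a (b + 2 * j + 1) + 1, b + 2 * j + 1, 1, by omega, by omega,
      le_rfl, mult_pos P hmem⟩
    have hv : v ∈ UVertices P a := hsub (Or.inl (hcover (b + 2 * j + 1) (by omega) le_rfl))
    rcases hv with ⟨i, hi⟩ | ⟨_, _, hu⟩
    · have hi' : b + 2 * j + 1 = a i ∨ b + 2 * j + 1 + 1 = a i := hi
      obtain ⟨i₁, hi₁⟩ := hj j le_rfl
      rcases hi' with hi' | hi'
      · have : i = i₁ := hT.eq_of_close (by omega) (by omega)
        subst this
        omega
      · exact hne' i hi'.symm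
    · simp only [v] at hu
      omega

/-- On an unpaired component with more than one column on its apex, the map `w` of the apex is
available. -/
lemma apex_mem_oddMins (ha : IsMaximalUTuple P a) {y : ℕ} (hy : y < s)
    (h2 : 2 * y + 2 ≤ apex n a y) (hp : ¬ Paired P a y) : apex n a y ∈ oddMins P := by
  have hb : apex n a y - 1 ∉ levels P := fun h => hp ⟨h, h2⟩
  have hbm := apex_mem ha.1 hy
  have hi₀ : a (Fin.rev ⟨y, hy⟩) = apex n a y := (apex_eq ⟨y, hy⟩).symm
  have hs : 2 * (s - (Fin.rev ⟨y, hy⟩ : Fin s)) ≤ apex n a y := by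
    simp only [Fin.val_rev]; omega
  revert hb hbm hi₀ hs h2
  generalize apex n a y = b
  intro h2 hb hbm hi₀ hs
  have hex : ∃ e, b ≤ e ∧ e + 1 ∉ levels P :=
    ⟨n + b, by omega, fun h => by have := levels_le P h; omega⟩
  classical
  obtain ⟨hbe, he⟩ := Nat.find_spec hex
  have hmin : ∀ l, b ≤ l → l ≤ Nat.find hex → l ∈ levels P := by
    intro l h1 h3
    rcases h1.eq_or_lt with rfl | h1
    · exact hbm
    · have := Nat.find_min hex (m := l - 1) (by omega)
      by_contra hc
      exact this ⟨by omega, by rwa [Nat.sub_add_cancel (by omega)]⟩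
  generalize Nat.find hex = e at hbe he hmin
  have hodd : ∃ r, e = b + 2 * r := by
    by_contra hc
    have hentry : ∀ j, ∀ m ≤ j, (∃ i, a i = b + 2 * m) ∧ b + 2 * m + 1 ≤ e := by
      intro j
      induction j with
      | zero =>
        intro m hm
        obtain rfl : m = 0 := by omega
        exact ⟨⟨_, hi₀⟩, by have h : e ≠ b := fun h => hc ⟨0, h⟩; omega⟩
      | succ j ih =>
        intro m hm
        rcases hm.eq_or_lt with rfl | hm
        · obtain ⟨i, hi⟩ := exists_eq_of_maximal ha hi₀ hs hb (fun m hm => (ih m hm).1)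
            fun m hm => hmin _ (by omega) (ih m hm).2
          have h3 := (ih j le_rfl).2
          have h4 : b + 2 * j + 1 ≠ e := fun h => he (by rw [← h, ← hi]; exact ha.1.mem i)
          have h5 : e ≠ b + 2 * (j + 1) := fun h => hc ⟨_, h⟩
          exact ⟨⟨i, by omega⟩, by omega⟩
        · exact ih m (by omega)
    have := (hentry e e le_rfl).2
    omega
  obtain ⟨r, hr⟩ := hodd
  refine mem_filter.2 ⟨hbm, Icc b e, ⟨⟨⟨b, e, hbe, rfl⟩, ?_⟩, ?_⟩, ?_, ?_⟩
  · intro l hl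
    rw [mem_Icc] at hl
    exact hmin l hl.1 hl.2
  · rintro _ ⟨⟨c, d, hcd, rfl⟩, hsub⟩ hle l hl
    have h3 := mem_Icc.1 (hle (mem_Icc.2 ⟨le_rfl, hbe⟩))
    have h4 := mem_Icc.1 (hle (mem_Icc.2 ⟨hbe, le_rfl⟩))
    rw [mem_Icc] at hl ⊢
    constructor
    · by_contra hc
      exact hb (hsub (mem_Icc.2 ⟨by omega, by omega⟩))
    · by_contra hc
      exact he (hsub (mem_Icc.2 ⟨by omega, by omega⟩))
  · rw [Nat.card_Icc, hr]
    exact ⟨r, by omega⟩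
  · rw [coe_Icc]
    exact isLeast_Icc hbe

end Maximality

/-! ### The components are chains of tight edges -/

section Lists

variable {α β : Type*}

lemma isChain_flatMap {R : α → α → Prop} {f : β → List α} {l : List β}
    (h₁ : ∀ b ∈ l, f b ≠ []) (h₂ : ∀ b ∈ l, (f b).IsChain R)
    (h₃ : l.IsChain fun b c => ∀ x ∈ (f b).getLast?, ∀ y ∈ (f c).head?, R x y) :
    (l.flatMap f).IsChain R := by
  rw [List.flatMap_def, List.isChain_flatten]
  · refine ⟨?_, (List.isChain_map f).2 h₃⟩
    intro l' hl'
    obtain ⟨b, hb, rfl⟩ := List.mem_map.1 hl'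
    exact h₂ b hb
  · intro h
    obtain ⟨b, hb, e⟩ := List.mem_map.1 h
    exact h₁ b hb e

lemma isChain_sort_ge (F : Finset ℕ) :
    (F.sort (· ≥ ·)).IsChain fun x y => (x ∈ F ∧ y ∈ F) ∧ y < x ∧ ∀ z ∈ F, z < x → z ≤ y := by
  rw [List.isChain_iff_getElem]
  intro i hi
  have hp := List.pairwise_iff_getElem.1 (F.sortedGT_sort).pairwise
  refine ⟨⟨(mem_sort _).1 (List.getElem_mem _), (mem_sort _).1 (List.getElem_mem _)⟩,
    hp i (i + 1) (by omega) hi (by omega), fun z hz hzx => ?_⟩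
  obtain ⟨j, hj, rfl⟩ := List.getElem_of_mem ((mem_sort (· ≥ ·)).2 hz)
  rcases lt_trichotomy j i with h | rfl | h
  · have := hp j i hj (by omega) h; omega
  · omega
  · rcases (show i + 1 ≤ j from h).eq_or_lt with rfl | h
    · exact le_rfl
    · exact (hp (i + 1) j hi hj h).le

lemma isChain_sort_le (F : Finset ℕ) :
    (F.sort (· ≤ ·)).IsChain fun x y => (x ∈ F ∧ y ∈ F) ∧ x < y ∧ ∀ z ∈ F, z < y → z ≤ x := by
  rw [List.isChain_iff_getElem]
  intro i hi
  have hp := List.pairwise_iff_getElem.1 (F.sortedLT_sort).pairwise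
  refine ⟨⟨(mem_sort _).1 (List.getElem_mem _), (mem_sort _).1 (List.getElem_mem _)⟩,
    hp i (i + 1) (by omega) hi (by omega), fun z hz hzx => ?_⟩
  obtain ⟨j, hj, rfl⟩ := List.getElem_of_mem ((mem_sort (· ≤ ·)).2 hz)
  rcases lt_trichotomy j i with h | rfl | h
  · exact (hp j i hj (by omega) h).le
  · exact le_rfl
  · rcases (show i + 1 ≤ j from h).eq_or_lt with rfl | h
    · omega
    · have := hp (i + 1) j hi hj h; omega

lemma getLast?_sort_ge {F : Finset ℕ} {x : ℕ} (h : x ∈ (F.sort (· ≥ ·)).getLast?) :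
    x ∈ F ∧ ∀ z ∈ F, x ≤ z := by
  have hp := List.pairwise_iff_getElem.1 (F.sortedGT_sort).pairwise
  have hx := List.mem_of_getLast? h
  refine ⟨(mem_sort _).1 hx, fun z hz => ?_⟩
  obtain ⟨j, hj, rfl⟩ := List.getElem_of_mem ((mem_sort (· ≥ ·)).2 hz)
  rw [Option.mem_def, List.getLast?_eq_getElem?, List.getElem?_eq_some_iff] at h
  obtain ⟨hl, rfl⟩ := h
  rcases (show j ≤ (F.sort (· ≥ ·)).length - 1 by omega).eq_or_lt with h | h
  · simp [h]
  · exact (hp _ _ hj hl h).le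

lemma head?_sort_le {F : Finset ℕ} {x : ℕ} (h : x ∈ (F.sort (· ≤ ·)).head?) :
    x ∈ F ∧ ∀ z ∈ F, x ≤ z := by
  have hp := List.pairwise_iff_getElem.1 (F.sortedLT_sort).pairwise
  have hx := List.mem_of_head? h
  refine ⟨(mem_sort _).1 hx, fun z hz => ?_⟩
  obtain ⟨j, hj, rfl⟩ := List.getElem_of_mem ((mem_sort (· ≤ ·)).2 hz)
  rw [Option.mem_def, List.head?_eq_getElem?, List.getElem?_eq_some_iff] at h
  obtain ⟨hl, rfl⟩ := h
  rcases Nat.eq_zero_or_pos j with h | h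
  · simp [h]
  · exact (hp _ _ hl hj h).le

lemma isChain_Ico (c d : ℕ) :
    (List.Ico c d).IsChain fun x y => y = x + 1 ∧ c ≤ x ∧ y < d := by
  rw [List.isChain_iff_getElem]
  intro i hi
  rw [List.Ico.length] at hi
  simp only [List.Ico, List.getElem_range']
  omega

end Lists

section Chains

variable {P : n.Partition} {s : ℕ} {a : Fin s → ℕ}

lemma mem_column {v : Vertex P} {u i : ℕ} (h : v ∈ column P u i) : v.u = u ∧ v.i = i := by
  unfold column at h
  split_ifs at h with hu
  · obtain ⟨k, -, rfl⟩ := List.mem_map.1 h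
    exact ⟨rfl, rfl⟩
  · simp at h

lemma column_length {u i : ℕ} (h : 1 ≤ u ∧ u ≤ i) : (column P u i).length = mult P i := by
  simp [column, h]

lemma column_eq_nil {u i : ℕ} (h : i ∉ levels P) : column P u i = [] := by
  have : mult P i = 0 := by
    by_contra hc
    exact h (Multiset.mem_toFinset.2 (Multiset.count_pos.1 (Nat.pos_of_ne_zero hc)))
  unfold column
  split_ifs with hu
  · rw [List.map_eq_nil_iff, ← List.length_eq_zero_iff, List.length_finRange, this]
  · rfl

lemma column_getElem {u i j : ℕ} (h : 1 ≤ u ∧ u ≤ i) (hj : j < (column P u i).length) :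
    (column P u i)[j].k = j + 1 := by
  simp [column, h]

variable (a) in
/-- Every edge from the end of one column to the beginning of another one is tight. A pair `(u, i)`
stands for the column of the vertices `(u, i, ·)`. -/
def TightStep (P : n.Partition) (p q : ℕ × ℕ) : Prop :=
  ∀ v v' : Vertex P, v.u = p.1 → v.i = p.2 → v.k = mult P p.2 →
    v'.u = q.1 → v'.i = q.2 → v'.k = 1 → TightEdge a v v'

lemma tightEdge_e {v v' : Vertex P} (hu : v'.u = v.u) (hi : v'.i = v.i) (hk : v'.k = v.k + 1) :
    TightEdge a v v' := by
  have h1 := v'.k_le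
  have h2 := v.one_le_k
  refine ⟨.e ⟨v.i, v.i_mem⟩ ⟨v.k, mem_Ico.2 ⟨h2, ?_⟩⟩, ⟨rfl, rfl, hu, hi, hk⟩, ?_⟩
  · simp only; rw [← hi]; omega
  · simp [potential, weight, hu, hi]

lemma isChain_column (u i : ℕ) : (column P u i).IsChain (TightEdge a) := by
  by_cases h : 1 ≤ u ∧ u ≤ i
  · rw [List.isChain_iff_getElem]
    intro j hj
    obtain ⟨h1, h2⟩ := mem_column (List.getElem_mem hj)
    obtain ⟨h3, h4⟩ := mem_column (List.getElem_mem (show j < (column P u i).length by omega))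
    refine tightEdge_e (by rw [h1, h3]) (by rw [h2, h4]) ?_
    rw [column_getElem h, column_getElem h]
  · simp [column, h]

lemma isChain_columns {l : List (ℕ × ℕ)}
    (hl : ∀ p ∈ l, (1 ≤ p.1 ∧ p.1 ≤ p.2) ∧ p.2 ∈ levels P) (hs : l.IsChain (TightStep a P)) :
    (l.flatMap fun p => column P p.1 p.2).IsChain (TightEdge a) := by
  refine isChain_flatMap (fun p hp => ?_) (fun p _ => isChain_column _ _) ?_
  · rw [← List.length_pos_iff, column_length (hl p hp).1]
    exact mult_pos P (hl p hp).2
  · rw [List.isChain_iff_getElem] at hs ⊢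
    intro i hi x hx y hy
    have hp := (hl _ (List.getElem_mem (show i < l.length by omega))).1
    have hq := (hl _ (List.getElem_mem hi)).1
    obtain ⟨h1, h2⟩ := mem_column (List.mem_of_getLast? hx)
    obtain ⟨h3, h4⟩ := mem_column (List.mem_of_head? hy)
    rw [Option.mem_def, List.getLast?_eq_getElem?, List.getElem?_eq_some_iff] at hx
    rw [Option.mem_def, List.head?_eq_getElem?, List.getElem?_eq_some_iff] at hy
    obtain ⟨hx, rfl⟩ := hx
    obtain ⟨hy, rfl⟩ := hy
    refine hs i hi _ _ h1 h2 ?_ h3 h4 ?_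
    · rw [column_getElem hp, column_length hp] at *
      omega
    · rw [column_getElem hq]

variable (P) in
/-- `l` and `m` are neighbouring levels, `l` being the lower one. -/
def Adjacent (l m : ℕ) : Prop :=
  (l ∈ levels P ∧ m ∈ levels P) ∧ l < m ∧ ∀ j ∈ levels P, j < m → j ≤ l

lemma Adjacent.exists_nonMin {l m : ℕ} (h : Adjacent P l m) :
    ∃ i : NonMin P, (i : ℕ) = m ∧ pred P m = l := by
  have hm : m ∈ (levels P).filter fun i => ∃ j ∈ levels P, j < i :=
    mem_filter.2 ⟨h.1.2, l, h.1.1, h.2.1⟩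
  obtain ⟨h1, h2, h3⟩ := pred_spec hm
  exact ⟨⟨m, hm⟩, rfl, le_antisymm (h.2.2 _ h1 h2) (h3 l h.1.1 h.2.1)⟩

lemma tightStep_down {l m u : ℕ} (h : Adjacent P l m) (hh : height P a l u = height P a m u) :
    TightStep a P (u, m) (u, l) := by
  obtain ⟨i, rfl, hp⟩ := h.exists_nonMin
  rintro v v' h1 h2 h3 h4 h5 h6
  refine ⟨.s i, ⟨h2, h3, h4.trans h1.symm, h5.trans hp.symm, h6⟩, ?_⟩
  simp only at h1 h2 h4 h5
  simp [potential, weight, h1, h2, h4, h5, hh]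

lemma tightStep_up {l m u w : ℕ} (h : Adjacent P l m) (hw : w + l = u + m)
    (hh : height P a l (l + 1 - u) = height P a m (l + 1 - u)) :
    TightStep a P (u, l) (w, m) := by
  obtain ⟨i, rfl, hp⟩ := h.exists_nonMin
  rintro v v' h1 h2 h3 h4 h5 h6
  simp only at h1 h2 h3 h4 h5
  have hm : Maps (.t i) v v' :=
    ⟨h2.trans hp.symm, by rw [hp, h3], by rw [hp, h4, h1, hw], h5, h6⟩
  refine ⟨.t i, hm, ?_⟩
  have := potential_t (a := a) hm
  rw [hp, h1, h2, hh] at this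
  omega

lemma tightStep_w {l u : ℕ} (h : l ∈ oddMins P) (hl : ∃ y, l = apex n a y)
    (hs : slope P a l u = 2 * l) : TightStep a P (u, l) (u + 1, l) := by
  rintro v v' h1 h2 h3 h4 h5 h6
  simp only at h1 h2 h3 h4 h5
  have hm : Maps (.z ⟨l, h⟩) v v' := ⟨h2, h3, by rw [h4, h1], h5, h6⟩
  refine ⟨_, hm, ?_⟩
  rw [potential_z hm]
  simp only [weight, if_pos hl, h1, hs]
  push_cast
  rfl

variable (P a) in
open Classical in
/-- The columns over one value of `u` in the part of the component `y` between its hooks. -/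
noncomputable def middleColumns (y u : ℕ) : List (ℕ × ℕ) :=
  (u, apex n a y) :: if Paired P a y ∧ u + y + 1 ≤ apex n a y then [(u, apex n a y - 1)] else []

variable (P a) in
/-- The columns of the component `y`, in order. -/
noncomputable def columnList (y : ℕ) : List (ℕ × ℕ) :=
  (((levels P).filter (apex n a y < ·)).sort (· ≥ ·)).map (fun l => (y + 1, l)) ++
  (List.Ico (y + 1) (apex n a y - y + 1)).flatMap (middleColumns P a y) ++
  (((levels P).filter (apex n a y < ·)).sort (· ≤ ·)).map fun l => (l - y, l)

lemma component_eq (ha : IsUTuple P a) (y : Fin s) :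
    component P a y = (columnList P a y).flatMap fun p => column P p.1 p.2 := by
  have hb := two_mul_lt_apex ha y
  rw [component, hookChain, columnList, ← apex_eq (n := n) (a := a) y, List.flatMap_append, List.flatMap_append,
    List.flatMap_map, List.flatMap_map, List.flatMap_assoc]
  congr 1
  · congr 1
    rw [show apex n a y + 2 - (y + 1) = apex n a y - y + 1 by omega]
    refine List.flatMap_congr fun u hu => ?_
    rw [List.Ico.mem] at hu
    unfold middleColumns
    rw [List.flatMap_cons]
    congr 1
    by_cases hp : Paired P a y
    · simp only [hp, true_and, ← add_assoc]
      split_ifs <;> simp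
    · simp only [hp, false_and, if_false, List.flatMap_nil]
      split_ifs with h
      · exact column_eq_nil fun h' => hp ⟨h', by omega⟩
      · rfl
  · simp

lemma mem_columnList (ha : IsUTuple P a) {y : ℕ} (hy : y < s) {p : ℕ × ℕ}
    (hp : p ∈ columnList P a y) :
    ((1 ≤ p.1 ∧ p.1 ≤ p.2) ∧ p.2 ∈ levels P) ∧
      ((apex n a y < p.2 ∧ (p.1 = y + 1 ∨ p.1 + y = p.2)) ∨
        (p.2 = apex n a y ∧ y + 1 ≤ p.1 ∧ p.1 + y ≤ p.2) ∨
        (p.2 + 1 = apex n a y ∧ y + 1 ≤ p.1 ∧ p.1 + y ≤ p.2)) := by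
  have hb := two_mul_lt_apex ha y
  have hbm := apex_mem ha hy
  rw [columnList, List.mem_append, List.mem_append, List.mem_map, List.mem_map,
    List.mem_flatMap] at hp
  rcases hp with (⟨l, hl, rfl⟩ | ⟨u, hu, hp⟩) | ⟨l, hl, rfl⟩
  · rw [mem_sort, mem_filter] at hl
    have := hl.2
    exact ⟨⟨⟨by omega, by simp only; omega⟩, hl.1⟩, Or.inl ⟨hl.2, Or.inl rfl⟩⟩
  · rw [List.Ico.mem] at hu
    rw [middleColumns, List.mem_cons] at hp
    rcases hp with rfl | hp
    · exact ⟨⟨⟨by dsimp only; omega, by dsimp only; omega⟩, hbm⟩, Or.inr (Or.inl ⟨rfl, by dsimp only; omega, by dsimp only; omega⟩)⟩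
    · split_ifs at hp with h
      · rw [List.mem_singleton] at hp
        subst hp
        simp only
        exact ⟨⟨by omega, h.1.1⟩, by omega⟩
      · simp at hp
  · rw [mem_sort, mem_filter] at hl
    simp only
    exact ⟨⟨by omega, hl.1⟩, by omega⟩

lemma isChain_columnList (ha : IsMaximalUTuple P a) {y : ℕ} (hy : y < s) :
    (columnList P a y).IsChain (TightStep a P) := by
  have hT := ha.1
  have hb := two_mul_lt_apex hT y
  have hbm := apex_mem hT hy
  set b := apex n a y with hbdef
  have hlow : ∀ l m, b ≤ l → Adjacent P l m → ∀ x ≤ y + 1, height P a l x = height P a m x :=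
    fun l m hl hlm x hx => height_eq_of_apex_le hT hl hlm.2.1 hx
  have hpair : Paired P a y → Adjacent P (b - 1) b := fun hp =>
    ⟨⟨hp.1, hbm⟩, by omega, fun j _ hj => by omega⟩
  have hmem : ∀ l, l ∈ (levels P).filter (b < ·) ↔ l ∈ levels P ∧ b < l := fun l => mem_filter
  -- a level just above the apex is adjacent to it
  have hadj : ∀ m, (m ∈ (levels P).filter (b < ·) ∧ ∀ z ∈ (levels P).filter (b < ·), m ≤ z) →
      Adjacent P b m := by
    rintro m ⟨h1, h2⟩
    rw [hmem] at h1
    refine ⟨⟨hbm, h1.1⟩, h1.2, fun j hj hjm => ?_⟩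
    by_contra hc
    have := h2 j ((hmem j).2 ⟨hj, by omega⟩)
    omega
  have hadj' : ∀ l m, (l ∈ (levels P).filter (b < ·) ∧ m ∈ (levels P).filter (b < ·)) → l < m →
      (∀ z ∈ (levels P).filter (b < ·), z < m → z ≤ l) → Adjacent P l m := by
    rintro l m ⟨h1, h2⟩ h3 h4
    rw [hmem] at h1 h2
    refine ⟨⟨h1.1, h2.1⟩, h3, fun j hj hjm => ?_⟩
    by_contra hc
    exact hc (h4 j ((hmem j).2 ⟨hj, by omega⟩) hjm)
  rw [columnList, List.append_assoc, List.isChain_append, List.isChain_append]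
  refine ⟨?_, ⟨?_, ?_, ?_⟩, ?_⟩
  · refine (List.isChain_map _).2 ((isChain_sort_ge _).imp fun l m h => ?_)
    have hA := hadj' m l h.1.symm h.2.1 h.2.2
    exact tightStep_down hA (hlow _ _ ((hmem m).1 h.1.2).2.le hA _ le_rfl)
  · refine isChain_flatMap (fun u _ => by simp [middleColumns]) (fun u hu => ?_) ?_
    · unfold middleColumns
      split_ifs with h
      · refine List.isChain_pair.2 (tightStep_down (hpair h.1) ?_)
        exact height_eq_of_paired hT h.1 (by omega)
      · exact List.isChain_singleton _
    · refine (isChain_Ico _ _).imp ?_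
      rintro u w ⟨rfl, hu1, hu2⟩ p hp q hq
      obtain rfl : (u + 1, b) = q := by simpa [middleColumns] using hq
      by_cases hpr : Paired P a y
      · have hif : Paired P a y ∧ u + y + 1 ≤ apex n a y := ⟨hpr, by omega⟩
        obtain rfl : (u, b - 1) = p := by simpa [middleColumns, hif] using hp
        exact tightStep_up (hpair hpr) (by omega) (height_eq_of_paired hT hpr (by omega))
      · obtain rfl : (u, b) = p := by simpa [middleColumns, hpr] using hp
        exact tightStep_w (apex_mem_oddMins ha hy (by omega) hpr) ⟨y, rfl⟩
          (slope_apex hT hpr hu1 (by omega))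
  · refine (List.isChain_map _).2 ((isChain_sort_le _).imp fun l m h => ?_)
    have hA := hadj' l m h.1 h.2.1 h.2.2
    have h1 := ((hmem l).1 h.1.1).2
    have h2 := ((hmem m).1 h.1.2).2
    exact tightStep_up hA (by omega) (hlow _ _ h1.le hA _ (by omega))
  · intro p hp q hq
    rw [List.Ico.succ_top (by omega), List.flatMap_append, List.flatMap_singleton] at hp
    have hp' : (b - y, b) = p := by
      have hif : ¬ (Paired P a y ∧ apex n a y - y + y + 1 ≤ apex n a y) := by omega
      rw [middleColumns, if_neg hif] at hp
      simpa using hp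
    rw [List.head?_map, Option.mem_def, Option.map_eq_some_iff] at hq
    obtain ⟨m, hm, rfl⟩ := hq
    have hA := hadj m (head?_sort_le hm)
    subst hp'
    exact tightStep_up hA (by have := hA.2.1; omega) (hlow _ _ le_rfl hA _ (by omega))
  · intro p hp q hq
    rw [List.getLast?_map, Option.mem_def, Option.map_eq_some_iff] at hp
    obtain ⟨m, hm, rfl⟩ := hp
    have hA := hadj m (getLast?_sort_ge hm)
    rw [List.Ico.eq_cons (by omega), List.flatMap_cons] at hq
    have hq' : (y + 1, b) = q := by simpa [middleColumns] using hq
    subst hq'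
    exact tightStep_down hA (hlow _ _ le_rfl hA _ le_rfl)

/-- The components are chains of tight edges. -/
lemma isChain_component (ha : IsMaximalUTuple P a) (y : Fin s) :
    (component P a y).IsChain (TightEdge a) := by
  rw [component_eq ha.1]
  exact isChain_columns (fun p hp => (mem_columnList ha.1 y.2 hp).1) (isChain_columnList ha y.2)

lemma inComponent_of_mem (ha : IsUTuple P a) {y : Fin s} {v : Vertex P}
    (hv : v ∈ component P a y) : InComponent a y v := by
  rw [component_eq ha, List.mem_flatMap] at hv
  obtain ⟨p, hp, hv⟩ := hv
  obtain ⟨h1, h2⟩ := mem_column hv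
  have := (mem_columnList ha y.2 hp).2
  rwa [← h1, ← h2] at this

end Chains

/-! ### Distinct indices give distinct vertices -/

section Injectivity

variable {P : n.Partition} {s : ℕ} {a : Fin s → ℕ}

/-- A quantity that increases along every edge of the augmented diagram: the horizontal position
`2 * u - i` in the diagram, refined by `k`. -/
def position (v : Vertex P) : ℤ := (2 * v.u - v.i) * (P.parts.card + 1) + v.k

lemma position_lt {γ : Var P} {v v' : Vertex P} (h : Maps γ v v') : position v < position v' := by
  have hk : v.k ≤ P.parts.card := v.k_le.trans (Multiset.count_le_card _ _)
  have hk' := v'.one_le_k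
  have key : (2 * (v.u : ℤ) - v.i) + 1 ≤ 2 * v'.u - v'.i → position v < position v' := by
    intro h
    have := mul_le_mul_of_nonneg_right h (show (0 : ℤ) ≤ P.parts.card + 1 by positivity)
    unfold position
    rw [add_mul] at this
    omega
  rcases γ with i | i | ⟨j, k⟩ | l <;> obtain ⟨h1, h2, h3, h4, h5⟩ := h
  · have := (pred_spec i.2).2.1
    exact key (by omega)
  · have := (pred_spec i.2).2.1
    exact key (by omega)
  · unfold position
    rw [h3, h4, ← h1, h5, ← h2]
    omega
  · exact key (by omega)

lemma nodup_of_isChain {l : List (Vertex P)} (h : l.IsChain (TightEdge a)) : l.Nodup := by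
  have h1 : (l.map position).IsChain (· < ·) :=
    (List.isChain_map _).2 (h.imp fun v w ⟨γ, hγ, _⟩ => position_lt hγ)
  have h2 := (List.isChain_iff_pairwise.1 h1).imp (S := (· ≠ ·)) fun h => h.ne
  exact List.Nodup.of_map _ h2

lemma eq_of_inComponent (ha : IsUTuple P a) {y z : ℕ} {v : Vertex P} (hy : InComponent a y v)
    (hz : InComponent a z v) : y = z := by
  wlog h : y < z generalizing y z
  · rcases (not_lt.1 h).eq_or_lt with h' | h'
    · exact h'.symm
    · exact (this hz hy h').symm
  have := apex_add_two_le ha h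
  have := two_mul_lt_apex ha z
  unfold InComponent at hy hz
  omega

lemma vertex_injective (ha : IsMaximalUTuple P a) : Function.Injective (vertex P a) := by
  rintro ⟨y, t⟩ ⟨z, t'⟩ h
  have hy : InComponent a y (vertex P a ⟨y, t⟩) := inComponent_of_mem ha.1 (List.get_mem _ _)
  have hz : InComponent a z (vertex P a ⟨z, t'⟩) := inComponent_of_mem ha.1 (List.get_mem _ _)
  rw [← h] at hz
  obtain rfl : y = z := Fin.ext (eq_of_inComponent ha.1 hy hz)
  obtain rfl : t = t' := (nodup_of_isChain (isChain_component ha y)).injective_get h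
  rfl

end Injectivity

/-! ### Weights of chains and uniqueness of the factorization -/

section Factorization

variable {P : n.Partition} {s : ℕ} {a : Fin s → ℕ}

lemma edgeMonomial_eq {γ : Var P} {v v' : Vertex P} (h : Maps γ v v') :
    edgeMonomial v v' = Finsupp.single γ 1 := by
  unfold edgeMonomial
  rw [Finset.sum_eq_single γ, if_pos h]
  · intro γ' _ hne
    exact if_neg fun h' => hne (h'.label_unique h)
  · simp

lemma chainMonomial_singleton (v : Vertex P) : chainMonomial [v] = 0 := rfl

lemma chainMonomial_cons_cons (v w : Vertex P) (l : List (Vertex P)) :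
    chainMonomial (v :: w :: l) = edgeMonomial v w + chainMonomial (w :: l) := by
  simp [chainMonomial]

lemma diagAug_of_tightEdge {v w : Vertex P} (h : TightEdge a v w) : DiagAug P v w :=
  let ⟨γ, hγ, _⟩ := h
  ⟨γ, hγ⟩

/-- Along a chain the potential increases at most by the weight of the monomial of the chain, with
equality exactly when all edges are tight. -/
lemma potential_chain (ha : IsUTuple P a) (l : List (Vertex P)) (v : Vertex P)
    (h : (v :: l).IsChain (DiagAug P)) :
    potential a ((v :: l).getLast (List.cons_ne_nil _ _)) ≤
        potential a v + Finsupp.weight (weight P a) (chainMonomial (v :: l)) ∧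
      (potential a ((v :: l).getLast (List.cons_ne_nil _ _)) =
        potential a v + Finsupp.weight (weight P a) (chainMonomial (v :: l)) ↔
      (v :: l).IsChain (TightEdge a)) := by
  induction l generalizing v with
  | nil => simp [chainMonomial_singleton]
  | cons w l ih =>
    rw [List.isChain_cons_cons] at h
    obtain ⟨⟨γ, hγ⟩, h⟩ := h
    obtain ⟨ih1, ih2⟩ := ih w h
    have hle := potential_le ha hγ
    rw [List.getLast_cons (List.cons_ne_nil _ _), chainMonomial_cons_cons, map_add,
      edgeMonomial_eq hγ, Finsupp.weight_single, one_smul, List.isChain_cons_cons, ← ih2]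
    refine ⟨by omega, ⟨fun h => ⟨⟨γ, hγ, by omega⟩, by omega⟩, ?_⟩⟩
    rintro ⟨⟨γ', hγ', e⟩, h⟩
    rw [hγ'.label_unique hγ] at e
    omega

lemma potential_chain' (ha : IsUTuple P a) {l : List (Vertex P)} {v w : Vertex P}
    (h : l.IsChain (DiagAug P)) (hv : l.head? = some v) (hw : l.getLast? = some w) :
    potential a w ≤ potential a v + Finsupp.weight (weight P a) (chainMonomial l) ∧
      (potential a w = potential a v + Finsupp.weight (weight P a) (chainMonomial l) ↔
        l.IsChain (TightEdge a)) := by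
  rcases l with _ | ⟨x, l⟩
  · simp at hv
  · obtain rfl : x = v := by simpa using hv
    rw [List.getLast?_eq_some_getLast (List.cons_ne_nil _ _), Option.some_inj] at hw
    subst hw
    exact potential_chain ha l x h

/-- A chain of tight edges that starts like a component stays in it. -/
lemma prefix_of_isChain (ha : IsUTuple P a) {y : ℕ} (c p : List (Vertex P))
    (hc : c.IsChain (TightEdge a)) (hp : p.IsChain (TightEdge a))
    (hy : ∀ v ∈ p, InComponent a y v) (hh : c.head? = p.head?) (hl : c.length ≤ p.length) :
    c <+: p := by
  induction c generalizing p with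
  | nil => exact List.nil_prefix
  | cons v c ih =>
    rcases p with _ | ⟨v', p⟩
    · simp at hh
    obtain rfl : v = v' := by simpa using hh
    refine (List.prefix_cons_inj v).2 ?_
    rcases c with _ | ⟨w, c⟩
    · exact List.nil_prefix
    rcases p with _ | ⟨w', p⟩
    · simp at hl
    refine ih _ hc.tail hp.tail (fun x hx => hy x (List.mem_cons_of_mem _ hx)) ?_ (by simpa using hl)
    rw [List.isChain_cons_cons] at hc hp
    rw [hc.1.unique ha (hy v List.mem_cons_self) hp.1]
    rfl

lemma isChain_standardChain (ha : IsMaximalUTuple P a) (r : Index P a) :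
    (standardChain P a r).IsChain (TightEdge a) :=
  (isChain_component ha r.1).take _

lemma length_standardChain (r : Index P a) : (standardChain P a r).length = (r.2 : ℕ) + 1 := by
  rw [standardChain, List.length_take]
  have := r.2.2
  omega

lemma head?_component (r : Index P a) : (component P a r.1).head? = some (start P a r) := by
  rw [List.head?_eq_getElem?, List.getElem?_eq_getElem (Fin.pos r.2)]
  rfl

lemma head?_standardChain (r : Index P a) :
    (standardChain P a r).head? = some (start P a r) := by
  rw [standardChain, List.head?_take, if_neg (by omega), head?_component]

lemma getLast?_standardChain (r : Index P a) :
    (standardChain P a r).getLast? = some (vertex P a r) := by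
  rw [List.getLast?_eq_getElem?, length_standardChain, standardChain, Nat.add_sub_cancel,
    List.getElem?_take_of_lt (by omega), List.getElem?_eq_getElem r.2.2]
  rfl

/-- The chain factorization by the standard chains. -/
noncomputable def standardFactorization (ha : IsMaximalUTuple P a) : ChainFactorization P a where
  mon r := chainMonomial (standardChain P a r)
  perm := 1
  chain := standardChain P a
  isChain r := (isChain_standardChain ha r).imp fun _ _ => diagAug_of_tightEdge
  length_eq := length_standardChain
  head_eq := head?_standardChain
  last_eq := getLast?_standardChain
  mon_eq _ := rfl

/-- A chain factorization of the distinguished monomial has the same total weight as the standard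
one, so all its edges are tight. -/
lemma ChainFactorization.isChain_tight (ha : IsMaximalUTuple P a) (f : ChainFactorization P a)
    (hf : f.monomial = distinguished P a) (r : Index P a) : (f.chain r).IsChain (TightEdge a) := by
  have hle : ∀ r, potential a (vertex P a (f.perm r)) ≤
      potential a (start P a r) + Finsupp.weight (weight P a) (f.mon r) := fun r => by
    rw [f.mon_eq]
    exact (potential_chain' ha.1 (f.isChain r) (f.head_eq r) (f.last_eq r)).1
  have hstd : ∀ r, potential a (vertex P a r) = potential a (start P a r) +
      Finsupp.weight (weight P a) (chainMonomial (standardChain P a r)) := fun r =>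
    (potential_chain' ha.1 ((standardFactorization ha).isChain r) (head?_standardChain r)
      (getLast?_standardChain r)).2.2 (isChain_standardChain ha r)
  have hsum : ∑ r, potential a (vertex P a (f.perm r)) =
      ∑ r, (potential a (start P a r) + Finsupp.weight (weight P a) (f.mon r)) := by
    rw [Equiv.sum_comp f.perm fun r => potential a (vertex P a r), Finset.sum_congr rfl
      fun r _ => hstd r, Finset.sum_add_distrib, Finset.sum_add_distrib, ← map_sum, ← map_sum]
    congr 2
    exact hf.symm
  have := (Finset.sum_eq_sum_iff_of_le fun r _ => hle r).1 hsum r (mem_univ r)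
  rw [f.mon_eq] at this
  exact (potential_chain' ha.1 (f.isChain r) (f.head_eq r) (f.last_eq r)).2.1 this

lemma ChainFactorization.eq_standard (ha : IsMaximalUTuple P a) (f : ChainFactorization P a)
    (hf : f.monomial = distinguished P a) : f = standardFactorization ha := by
  have hchain : ∀ r, f.chain r = standardChain P a r := fun r => by
    have hpre : f.chain r <+: component P a r.1 :=
      prefix_of_isChain ha.1 _ _ (f.isChain_tight ha hf r) (isChain_component ha r.1)
        (fun v hv => inComponent_of_mem ha.1 hv) (by rw [f.head_eq, head?_component])
        (by rw [f.length_eq]; exact r.2.2)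
    rw [List.prefix_iff_eq_take, f.length_eq] at hpre
    exact hpre
  refine ChainFactorization.ext (funext fun r => ?_) (Equiv.ext fun r => ?_) (funext hchain)
  · rw [f.mon_eq, hchain]; rfl
  · have h1 := f.last_eq r
    rw [hchain, getLast?_standardChain, Option.some_inj] at h1
    exact (vertex_injective ha h1).symm

end Factorization

/-! ### Expansion of the determinant over chain factorizations -/

section Expansion

variable (k : Type*) [Field k] {P : n.Partition} {s : ℕ} {a : Fin s → ℕ}

open Classical in
/-- The chains with `m + 1` vertices from `v` to `w`. -/
noncomputable def chainsBetween : ℕ → Vertex P → Vertex P → Finset (List (Vertex P))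
  | 0, v, w => if v = w then {[v]} else ∅
  | m + 1, v, w =>
    (univ.filter (DiagAug P v)).biUnion fun x => (chainsBetween m x w).image (List.cons v)

lemma mem_chainsBetween {m : ℕ} {v w : Vertex P} {l : List (Vertex P)} :
    l ∈ chainsBetween m v w ↔ l.IsChain (DiagAug P) ∧ l.length = m + 1 ∧ l.head? = some v ∧
      l.getLast? = some w := by
  induction m generalizing v l with
  | zero =>
    simp only [chainsBetween]
    constructor
    · intro h
      split_ifs at h with hvw
      · rw [mem_singleton] at h
        subst h hvw
        simp
      · simp at h
    · rintro ⟨-, h2, h3, h4⟩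
      obtain ⟨x, rfl⟩ := List.length_eq_one_iff.1 h2
      obtain rfl : x = v := by simpa using h3
      obtain rfl : x = w := by simpa using h4
      simp
  | succ m ih =>
    simp only [chainsBetween, mem_biUnion, mem_filter, mem_univ, true_and, mem_image, ih]
    constructor
    · rintro ⟨x, hvx, l, ⟨h1, h2, h3, h4⟩, rfl⟩
      rcases l with _ | ⟨x', l⟩
      · simp at h2
      obtain rfl : x' = x := by simpa using h3
      exact ⟨List.isChain_cons_cons.2 ⟨hvx, h1⟩, by simpa using h2, rfl,
        by rw [List.getLast?_cons_cons, h4]⟩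
    · rintro ⟨h1, h2, h3, h4⟩
      rcases l with _ | ⟨v', _ | ⟨x, l⟩⟩
      · simp at h2
      · simp at h2
      obtain rfl : v' = v := by simpa using h3
      rw [List.isChain_cons_cons] at h1
      rw [List.getLast?_cons_cons] at h4
      exact ⟨x, h1.1, x :: l, ⟨h1.2, by simpa using h2, rfl, h4⟩, rfl⟩

open Classical in
lemma simplyAdequate_apply (v w : Vertex P) :
    simplyAdequate k P v w = if DiagAug P v w then monomial (edgeMonomial v w) 1 else 0 := by
  rw [simplyAdequate, Matrix.sum_apply]
  simp only [Matrix.smul_apply, elemMatrix, Matrix.of_apply, smul_eq_mul, mul_ite, mul_one,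
    mul_zero]
  split_ifs with h
  · obtain ⟨γ, hγ⟩ := h
    rw [Finset.sum_eq_single γ, if_pos hγ, edgeMonomial_eq hγ]
    · rfl
    · exact fun γ' _ hne => if_neg fun h' => hne (h'.label_unique hγ)
    · simp
  · exact Finset.sum_eq_zero fun γ _ => if_neg fun h' => h ⟨γ, h'⟩

/-- An entry of a power of the simply adequate matrix is the sum of the monomials of the chains
joining its row to its column. -/
lemma simplyAdequate_pow_apply (m : ℕ) (v w : Vertex P) :
    (simplyAdequate k P ^ m) v w = ∑ l ∈ chainsBetween m v w, monomial (chainMonomial l) 1 := by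
  classical
  induction m generalizing v with
  | zero =>
    simp only [pow_zero, Matrix.one_apply, chainsBetween]
    split_ifs with h
    · simp [chainMonomial_singleton]
    · simp
  | succ m ih =>
    rw [pow_succ', Matrix.mul_apply, chainsBetween, Finset.sum_biUnion]
    · simp only [simplyAdequate_apply, ite_mul, zero_mul, ← Finset.sum_filter]
      refine Finset.sum_congr (by ext; simp) fun x hx => ?_
      rw [Finset.sum_image fun _ _ _ _ h => List.cons_injective h, ih, Finset.mul_sum]
      refine Finset.sum_congr rfl fun l hl => ?_
      rw [mem_chainsBetween] at hl
      rcases l with _ | ⟨x', l⟩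
      · simp at hl
      obtain rfl : x' = x := by simpa using hl.2.2.1
      rw [chainMonomial_cons_cons, monomial_mul, one_mul]
    · intro x _ y _ hxy
      rw [Function.onFun, Finset.disjoint_left]
      rintro l hl hl'
      obtain ⟨l₁, hl₁, rfl⟩ := mem_image.1 hl
      obtain ⟨l₂, hl₂, e⟩ := mem_image.1 hl'
      obtain rfl := List.cons_injective e
      have h1 := (mem_chainsBetween.1 hl₁).2.2.1
      rw [(mem_chainsBetween.1 hl₂).2.2.1, Option.some_inj] at h1
      exact hxy h1.symm

/-- The coefficient of the distinguished monomial in `det M_𝔄` is the signed number of its chain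
factorizations, and the standard one is the only one. -/
lemma coeff_det_matrixM (ha : IsMaximalUTuple P a) :
    coeff (distinguished P a) (matrixM P a k).det = 1 := by
  classical
  have hterm : ∀ (σ : Equiv.Perm (Index P a)) (C : Index P a → List (Vertex P)),
      C ∈ Fintype.piFinset
        (fun r : Index P a => chainsBetween (r.2 : ℕ) (start P a r) (vertex P a (σ r))) →
      ∑ r, chainMonomial (C r) = distinguished P a → σ = 1 ∧ C = standardChain P a := by
    intro σ C hC hsum
    simp only [Fintype.mem_piFinset, mem_chainsBetween] at hC
    let f : ChainFactorization P a :=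
      { mon := fun r => chainMonomial (C r), perm := σ, chain := C, isChain := fun r => (hC r).1,
        length_eq := fun r => (hC r).2.1, head_eq := fun r => (hC r).2.2.1,
        last_eq := fun r => (hC r).2.2.2, mon_eq := fun _ => rfl }
    have hf := f.eq_standard ha hsum
    exact ⟨congrArg ChainFactorization.perm hf, congrArg ChainFactorization.chain hf⟩
  have hcoeff : ∀ σ : Equiv.Perm (Index P a),
      coeff (distinguished P a) (∏ r, matrixM P a k r (σ r)) =
        ∑ C ∈ Fintype.piFinset
          (fun r : Index P a => chainsBetween (r.2 : ℕ) (start P a r) (vertex P a (σ r))),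
          if ∑ r, chainMonomial (C r) = distinguished P a then (1 : k) else 0 := by
    intro σ
    simp only [matrixM, Matrix.of_apply, simplyAdequate_pow_apply]
    rw [Finset.prod_univ_sum, coeff_sum]
    refine Finset.sum_congr rfl fun C _ => ?_
    rw [← coeff_monomial, monomial_sum_one]
  rw [← Matrix.det_transpose, Matrix.det_apply', coeff_sum, Finset.sum_eq_single 1]
  · simp only [Matrix.transpose_apply, Equiv.Perm.sign_one, Units.val_one, Int.cast_one, one_mul]
    rw [hcoeff, Finset.sum_eq_single (standardChain P a)]
    · exact if_pos rfl
    · exact fun C hC hne => if_neg fun h => hne (hterm _ C hC h).2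
    · intro h
      refine (h ?_).elim
      rw [Fintype.mem_piFinset]
      exact fun r => mem_chainsBetween.2 ⟨(standardFactorization ha).isChain r,
        length_standardChain r, head?_standardChain r, getLast?_standardChain r⟩
  · intro σ _ hσ
    have h0 : coeff (distinguished P a) (∏ r, matrixM P a k r (σ r)) = 0 := by
      rw [hcoeff]
      exact Finset.sum_eq_zero fun C hC => if_neg fun h => hσ (hterm σ C hC h).1
    simp only [Matrix.transpose_apply]
    rw [← map_intCast (C : k →+* MvPolynomial (Var P) k), coeff_C_mul, h0, mul_zero]
  · simp

end Expansion

end MultiUChain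

theorem theorem3p7 (k : Type*) [Field k] {n : ℕ} (P : n.Partition) {s : ℕ} (a : Fin s → ℕ)
    (ha : MultiUChain.IsMaximalUTuple P a) :
    (∃ g : MultiUChain.ChainFactorization P a,
      g.perm = 1 ∧ (∀ r, g.chain r = MultiUChain.standardChain P a r) ∧
      g.monomial = MultiUChain.distinguished P a ∧
      ∀ f : MultiUChain.ChainFactorization P a,
        f.monomial = MultiUChain.distinguished P a → f = g) ∧
    MvPolynomial.coeff (MultiUChain.distinguished P a) (MultiUChain.matrixM P a k).det = 1 ∧
    (MultiUChain.matrixM P a k).det ≠ 0 := by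
  refine ⟨⟨MultiUChain.standardFactorization ha, rfl, fun _ => rfl, rfl,
    fun f hf => f.eq_standard ha hf⟩, MultiUChain.coeff_det_matrixM k ha, fun h => ?_⟩
  have h1 := MultiUChain.coeff_det_matrixM k ha
  rw [h, MvPolynomial.coeff_zero] at h1
  exact zero_ne_one h1
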